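/- **Setting.** Let $A^*\in\{0,1\}^{n\times n}$ be the (random) adjacency matrix of a graph, $X\in\mathbb R^{n\times d}$ a random matrix of node covariates, and $\Omega\in\{0,1\}^{n\times n}$ a sampling matrix such that, conditionally on $(A^*,X)$, the entries $\Omega_{i,j}$ are independent Bernoulli variables with parameter $w_0$ if $A^*_{i,j}=0$ and $w_1$ if $A^*_{i,j}=1$, for some $w_0,w_1\in[0,1]$. Put $A_{i,j}=\Omega_{i,j}A^*_{i,j}$, $\mathcal D_{\rm test}=\{(i,j):\Omega_{i,j}=0\}$, $m=|\mathcal D_{\rm test}|$, $\mathcal D^a=\{(i,j):\Omega_{i,j}=1,\ A^*_{i,j}=a\}$ for $a\in\{0,1\}$, and $\mathcal H_0=\{(i,j):\Omega_{i,j}=0,\ A^*_{i,j}=0\}$. Let $\ell\le|\mathcal D^0|$ be a function of $|\mathcal D^0|$ and $\mathcal D^1$ only and, given $(A^*,X,\Omega)$, let $\mathcal D_{\rm cal}$ be a uniformly drawn subset of $\mathcal D^0$ of size $\ell$. Let $\Omega^{\rm train}_{i,j}=0$ if $(i,j)\in\mathcal D_{\rm cal}$ and $\Omega^{\rm train}_{i,j}=\Omega_{i,j}$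 otherwise. Let $g$ be a measurable function of $(A,X,\Omega)$ with values in $\mathbb R^{n\times n}$ and let $S=g(A,X,\Omega^{\rm train})$ be the scores; assume that the entries $(S_{i,j})_{1\le i,j\le n}$ are almost surely pairwise distinct. For $(i,j)\in\mathcal D_{\rm test}$ define the conformal p-value $$p_{i,j}=\frac1{\ell+1}\Big(1+\sum_{(u,v)\in\mathcal D_{\rm cal}}\mathbf 1\{S_{i,j}\le S_{u,v}\}\Big),$$ and for $t\in[0,1]$ let $R(t)=\{(i,j)\in\mathcal D_{\rm test}: p_{i,j}\le t\}$ and $\mathrm{FDP}(R(t))=\dfrac{|R(t)\cap\mathcal H_0|}{1\vee|R(t)|}$. **Universal distribution.** For integers $m,\ell\ge0$, draw $m$ times from a Pólya urn that initially contains $\ell+1$ balls of different colours $0,\dots,\ell$ (each drawn ball is put back together with one more ball of its colour), and let $C_j$ be the number of draws of colour $j$. Let $P_{m,\ell}$ be the law of $\sup_{t\in[0,1]}(\hat F(t)-t)$, where $\hat F(t)=\frac1m\sum_{j:\,(j+1)/(\ell+1)\le t}C_j$ (and $\hat F=0$ if $m=0$). For $\delta\in(0,1)$ let $\lambda(m,\ell,\delta)$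 be the $(1-\delta)$-quantile of $P_{m,\ell}$, that is, the least $x$ with $P_{m,\ell}((-\infty,x])\ge1-\delta$. **Theorem.** For every $\delta\in(0,1)$, almost surely, $$\mathbb P\Big(\forall t\in[0,1]:\ \mathrm{FDP}(R(t))\le\frac{m}{1\vee|R(t)|}\,\big(t+\lambda(m,\ell,\delta)\big)\ \Big|\ A^*,X\Big)\ \ge\ 1-\delta,$$ so that the same event has probability at least $1-\delta$ also unconditionally. Moreover, for all integers $m,\ell\ge1$, $$\lambda(m,\ell,\delta)\le\left(\frac{\log\delta^{-1}+\log\big(1+2\sqrt\pi\,(m\wedge\ell)\big)}{m\wedge\ell}\right)^{1/2}.$$ -/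

import Mathlib

open MeasureTheory ProbabilityTheory
open scoped ENNReal

noncomputable section

namespace LinkPred

/-! ### The Pólya urn, the universal distribution and its quantiles -/

/-- One draw from an urn that contains one initial ball of each of the `N + 1` colours and, for each
colour `j`, `c j` further balls of that colour: colour `j` has probability proportional
to `1 + c j`. -/
def drawColour {N : ℕ} (c : Fin (N + 1) → ℕ) : PMF (Fin (N + 1)) :=
  PMF.normalize (fun j => ((1 + c j : ℕ) : ℝ≥0∞))
    (by
      rw [tsum_fintype]
      intro h
      have h0 := (Finset.sum_eq_zero_iff.mp h) 0 (Finset.mem_univ _)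
      rw [Nat.cast_eq_zero] at h0
      omega)
    (by
      rw [tsum_fintype]
      exact ENNReal.sum_ne_top.mpr fun j _ => ENNReal.natCast_ne_top _)

/-- The law of the colour histogram (number of draws of each colour) after a given number of draws
from a Pólya urn that initially contains `N + 1` balls of different colours. Each drawn ball is put
back together with one more ball of its colour. -/
def polyaHistogram (N : ℕ) : ℕ → PMF (Fin (N + 1) → ℕ)
  | 0 => PMF.pure 0
  | m + 1 => (polyaHistogram N m).bind fun c => (drawColour c).map fun j => c + Pi.single j 1

/-- The empirical cdf of a histogram `c` of `m` draws, where colour number `j` (counted from `0`)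
stands for the point `(j + 1) / (N + 1)` of `[0, 1]`. -/
def histCdf {N : ℕ} (m : ℕ) (c : Fin (N + 1) → ℕ) (t : ℝ) : ℝ :=
  (∑ j : Fin (N + 1), if ((j : ℝ) + 1) / ((N : ℝ) + 1) ≤ t then (c j : ℝ) else 0) / m

/-- The supremum over `t ∈ [0, 1]` of the (upper) deviation of the empirical cdf
from the identity. -/
def supDeviation {N : ℕ} (m : ℕ) (c : Fin (N + 1) → ℕ) : ℝ :=
  ⨆ t : Set.Icc (0 : ℝ) 1, (histCdf m c t - t)

/-- The universal distribution `P_{m,ℓ}`: the law of the supremum deviation for `m` draws from a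
Pólya urn that initially contains `ℓ + 1` balls of different colours. -/
def universalLaw (m ℓ : ℕ) : Measure ℝ :=
  ((polyaHistogram ℓ m).map (supDeviation m)).toMeasure

/-- The quantile of order `q` of a distribution on the real line. -/
def quantile (μ : Measure ℝ) (q : ℝ) : ℝ :=
  sInf {x : ℝ | q ≤ μ.real (Set.Iic x)}

/-- `λ(m, ℓ, δ)`, the `(1 - δ)`-quantile of `P_{m,ℓ}`. -/
def lam (m ℓ : ℕ) (δ : ℝ) : ℝ :=
  quantile (universalLaw m ℓ) (1 - δ)

/-! ### Link prediction -/

/-- A `{0, 1}`-valued `n × n` matrix. -/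
abbrev BMat (n : ℕ) := Fin n → Fin n → Bool

/-- A real `n × d` matrix. -/
abbrev RMat (n d : ℕ) := Fin n → Fin d → ℝ

/-- The observation space: adjacency matrix, node covariates, sampling matrix. -/
abbrev Obs (n d : ℕ) := BMat n × RMat n d × BMat n

/-- The observed adjacency matrix `A i j = Ω i j * A* i j`. -/
def observed {n : ℕ} (a o : BMat n) : BMat n :=
  fun i j => o i j && a i j

/-- The test set: node pairs that are not sampled. -/
def testSet {n : ℕ} (o : BMat n) : Finset (Fin n × Fin n) :=
  {e | o e.1 e.2 = false}

/-- `D⁰`, the observed false edges. -/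
def obsFalse {n : ℕ} (a o : BMat n) : Finset (Fin n × Fin n) :=
  {e | o e.1 e.2 = true ∧ a e.1 e.2 = false}

/-- `D¹`, the observed true edges. -/
def obsTrue {n : ℕ} (a o : BMat n) : Finset (Fin n × Fin n) :=
  {e | o e.1 e.2 = true ∧ a e.1 e.2 = true}

/-- `H₀`, the false edges in the test set. -/
def nullSet {n : ℕ} (a o : BMat n) : Finset (Fin n × Fin n) :=
  {e | o e.1 e.2 = false ∧ a e.1 e.2 = false}

/-- The calibration set size, given as a function `L` of `|D⁰|` and of `D¹`. -/
def calSize {n : ℕ} (L : ℕ → Finset (Fin n × Fin n) → ℕ) (a o : BMat n) : ℕ :=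
  L (obsFalse a o).card (obsTrue a o)

/-- The training sampling matrix, in which the calibration pairs are treated as missing. -/
def trainMask {n : ℕ} (o : BMat n) (D : Finset (Fin n × Fin n)) : BMat n :=
  fun i j => if (i, j) ∈ D then false else o i j

/-- The score of a node pair, computed by `g` from the training data `(A, X, Ω_train)`. -/
def score {n d : ℕ} (g : Obs n d → RMat n n) (a : BMat n)
    (x : RMat n d) (o : BMat n) (D : Finset (Fin n × Fin n))
    (e : Fin n × Fin n) : ℝ :=
  g (observed a o, x, trainMask o D) e.1 e.2

/-- The conformal p-value of `e`, for scores `S` and calibration set `D`. -/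
def pValue {n : ℕ} (S : Fin n × Fin n → ℝ) (D : Finset (Fin n × Fin n)) (e : Fin n × Fin n) : ℝ :=
  (1 + ∑ f ∈ D, if S e ≤ S f then (1 : ℝ) else 0) / ((D.card : ℝ) + 1)

/-- The rejection set `R(t)`: the test pairs with conformal p-value at most `t`. -/
def rejSet {n d : ℕ} (g : Obs n d → RMat n n) (a : BMat n)
    (x : RMat n d) (o : BMat n) (D : Finset (Fin n × Fin n)) (t : ℝ) :
    Finset (Fin n × Fin n) :=
  {e ∈ testSet o | pValue (score g a x o D) D e ≤ t}

/-- The false discovery proportion of `R` when the false edges of the test set are `H`. -/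
def fdp {n : ℕ} (H R : Finset (Fin n × Fin n)) : ℝ :=
  ((H ∩ R).card : ℝ) / (max 1 R.card : ℕ)

/-- The Bernoulli probability of `b` for a pair whose true status is `v`, with sampling rate `w₀`
for false and `w₁` for true edges. -/
def sampleProb (w₀ w₁ : ℝ) (v b : Bool) : ℝ :=
  if b then (if v then w₁ else w₀) else 1 - (if v then w₁ else w₀)

/-- The σ-algebra generated by a random variable. -/
abbrev sigmaOf {Ω α : Type*} [MeasurableSpace α] (Y : Ω → α) : MeasurableSpace Ω :=
  MeasurableSpace.comap Y inferInstance

end LinkPred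

end

namespace LinkPred

/-! ### The Pólya urn -/

/-! The argument is exchangeability after conditioning. Fix `(A*, X)`, the training mask `τ` and `k
= |D⁰|`. Hiding or revealing a false edge does not alter the observed adjacency matrix, so the score
function is fixed. So are the calibration size `N`, the number `m` of test pairs and the set `W` of
false edges hidden by `τ`. Every false edge is sampled at the same rate `w₀`, so all `N`-subsets `D`
of `W` have equal weight as calibration set (`sampleWeight_unmask`, `filter_maskAndCount_eq`), and
`W \ D` is the set of test nulls.

The p-value of a null is a function of its rank among the calibration scores. Without ties, an
`N`-subset of `W` can be recovered from the histogram of the ranks of its complement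
(`injOn_rankHistogram`). The Pólya histogram is uniform over all histograms with the right total
(`polyaHistogram_apply`), so a set of histograms is hit by at most its urn probability with `|W| -
N` draws. The relevant event is upward closed and urn counts only grow, so the number of draws may
be raised to `m` (`polyaHistogram_mono`). There the definition of the quantile gives the bound `δ`.
Summing over the fibres of `maskAndCount` gives the conditional statement, and integrating it gives
the unconditional one.

The explicit quantile bound rests on the martingale formed by the proportion of balls in a set of
colours. Its conditional ranges have summable squares that telescope, which gives a sub-Gaussian
tail (`polyaHistogram_tail_le`). A union bound over about `min m ℓ` colour sets then controls the
supremum. -/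

theorem drawColour_apply {N : ℕ} (c : Fin (N + 1) → ℕ) (j : Fin (N + 1)) :
    drawColour c j = ((1 + c j : ℕ) : ℝ≥0∞) / ((N + 1 + ∑ i, c i : ℕ) : ℝ≥0∞) := by
  rw [drawColour, PMF.normalize_apply, tsum_fintype, ← Nat.cast_sum, Finset.sum_add_distrib]
  simp [div_eq_mul_inv]

theorem sum_drawColour {N : ℕ} (c : Fin (N + 1) → ℕ) : ∑ j, drawColour c j = 1 := by
  rw [← tsum_fintype (L := .unconditional _)]
  exact PMF.tsum_coe _

theorem tsum_bind_mul {α β : Type*} (p : PMF α) (k : α → PMF β) (f : β → ℝ≥0∞) :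
    ∑' b, p.bind k b * f b = ∑' a, p a * ∑' b, k a b * f b := by
  simp_rw [PMF.bind_apply, ← ENNReal.tsum_mul_right, ← ENNReal.tsum_mul_left]
  rw [ENNReal.tsum_comm]
  simp_rw [mul_assoc]

theorem tsum_map_mul {α β : Type*} (p : PMF α) (h : α → β) (f : β → ℝ≥0∞) :
    ∑' b, p.map h b * f b = ∑' a, p a * f (h a) := by
  rw [PMF.map, tsum_bind_mul]
  refine tsum_congr fun a => ?_
  congr 1
  rw [tsum_eq_single (h a)]
  · simp
  · intro b hb
    simp [hb]

theorem tsum_polyaHistogram_succ {N : ℕ} (m : ℕ) (f : (Fin (N + 1) → ℕ) → ℝ≥0∞) :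
    ∑' c, polyaHistogram N (m + 1) c * f c =
      ∑' c, polyaHistogram N m c * ∑ j, drawColour c j * f (c + Pi.single j 1) := by
  rw [polyaHistogram, tsum_bind_mul]
  simp_rw [tsum_map_mul, tsum_fintype]

theorem sum_add_single {N : ℕ} (c : Fin (N + 1) → ℕ) (j : Fin (N + 1)) (J : Finset (Fin (N + 1))) :
    ∑ i ∈ J, (c + Pi.single j 1 : Fin (N + 1) → ℕ) i = ∑ i ∈ J, c i + if j ∈ J then 1 else 0 := by
  simp [Finset.sum_add_distrib, Pi.single_apply]

theorem polyaHistogram_succ_apply {N : ℕ} (m : ℕ) (c : Fin (N + 1) → ℕ) :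
    polyaHistogram N (m + 1) c = ∑ j, if c j = 0 then 0 else
      polyaHistogram N m (c - Pi.single j 1) * drawColour (c - Pi.single j 1) j := by
  have h := tsum_polyaHistogram_succ (N := N) m (fun b => if b = c then 1 else 0)
  rw [tsum_eq_single c (fun b hb => by simp [hb])] at h
  simp only [if_true, mul_one] at h
  rw [h]
  simp_rw [Finset.mul_sum]
  rw [Summable.tsum_finsetSum (fun _ _ => ENNReal.summable)]
  refine Finset.sum_congr rfl fun j _ => ?_
  split_ifs with hj
  · rw [ENNReal.tsum_eq_zero]
    intro b
    rw [if_neg]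
    · simp
    · intro hb
      have := congrFun hb j
      simp at this
      omega
  · have hc : c - Pi.single j 1 + Pi.single j 1 = c := by
      funext i
      by_cases hi : i = j
      · subst hi; simp; omega
      · simp [hi]
    rw [tsum_eq_single (c - Pi.single j 1)]
    · simp [hc]
    · intro b hb
      rw [if_neg]
      · simp
      · rintro rfl
        apply hb
        simp

/-- The histogram of the draws is uniformly distributed. -/
theorem polyaHistogram_apply (N m : ℕ) (c : Fin (N + 1) → ℕ) :
    polyaHistogram N m c =
      if ∑ i, c i = m then (((m + N).choose N : ℕ) : ℝ≥0∞)⁻¹ else 0 := by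
  induction m generalizing c with
  | zero =>
    have : ∑ i, c i = 0 ↔ c = 0 := by
      simp [Finset.sum_eq_zero_iff, funext_iff]
    simp [polyaHistogram, PMF.pure_apply, this]
  | succ m ih =>
    rw [polyaHistogram_succ_apply]
    have key : ∀ j, c j ≠ 0 → ∑ i, (c - Pi.single j 1 : Fin (N + 1) → ℕ) i + 1 = ∑ i, c i := by
      intro j hj
      have hc : c - Pi.single j 1 + Pi.single j 1 = c := by
        funext i
        by_cases hi : i = j
        · subst hi; simp; omega
        · simp [hi]
      conv_rhs => rw [← hc, sum_add_single]
      simp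
    split_ifs with hm
    -- The last draw had colour `j` with probability `c j / (N + 1 + m)`, since the urn then held `c
    -- j` balls of that colour. By induction the predecessors are equally likely, and the `c j` add
    -- up to `m + 1`, whatever `c` is.
    · have : ∀ j, (if c j = 0 then 0 else polyaHistogram N m (c - Pi.single j 1) *
            drawColour (c - Pi.single j 1) j) =
          (c j : ℝ≥0∞) * ((((m + N).choose N : ℕ) : ℝ≥0∞)⁻¹ * ((N + 1 + m : ℕ) : ℝ≥0∞)⁻¹) := by
        intro j
        split_ifs with hj
        · simp [hj]
        · have hs : ∑ i, (c - Pi.single j 1 : Fin (N + 1) → ℕ) i = m := by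
            have := key j hj
            omega
          rw [ih, if_pos hs, drawColour_apply, hs]
          have : 1 + (c - Pi.single j 1 : Fin (N + 1) → ℕ) j = c j := by
            simp; omega
          rw [this, div_eq_mul_inv]
          ring
      simp_rw [this]
      rw [← Finset.sum_mul, ← Nat.cast_sum, hm, ← ENNReal.mul_inv (by simp) (by simp),
        ← Nat.cast_mul]
      have hch : (m + N).choose N * (N + 1 + m) = (m + 1 + N).choose N * (m + 1) := by
        have := Nat.choose_mul_succ_eq (m + N) N
        rwa [show m + N + 1 - N = m + 1 by omega, show m + N + 1 = m + 1 + N by ring,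
          show (m + N).choose N * (m + 1 + N) = (m + N).choose N * (N + 1 + m) by ring] at this
      rw [hch, Nat.cast_mul, ENNReal.mul_inv (by simp) (by simp), mul_comm, mul_assoc,
        ENNReal.inv_mul_cancel (by simp) (by finiteness), mul_one]
    · refine Finset.sum_eq_zero fun j _ => ?_
      split_ifs with hj
      · rfl
      · rw [ih, if_neg, zero_mul]
        have := key j hj
        omega

theorem toMeasure_eq_tsum {α : Type*} [MeasurableSpace α] [DiscreteMeasurableSpace α]
    (p : PMF α) (s : Set α) [DecidablePred (· ∈ s)] :
    p.toMeasure s = ∑' a, p a * if a ∈ s then 1 else 0 := by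
  rw [PMF.toMeasure_apply _ (MeasurableSet.of_discrete)]
  refine tsum_congr fun a => ?_
  simp [Set.indicator_apply]

/-- A further draw can only increase the counts, so it never leaves an upper set. -/
theorem polyaHistogram_le_succ {N : ℕ} (m : ℕ) {U : Set (Fin (N + 1) → ℕ)} (hU : IsUpperSet U) :
    (polyaHistogram N m).toMeasure U ≤ (polyaHistogram N (m + 1)).toMeasure U := by
  classical
  rw [toMeasure_eq_tsum, toMeasure_eq_tsum, tsum_polyaHistogram_succ]
  refine ENNReal.tsum_le_tsum fun c => mul_le_mul_right ?_ _
  split_ifs with hc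
  · refine (sum_drawColour c).ge.trans (Finset.sum_le_sum fun j _ => ?_)
    rw [if_pos (hU (a := c) (by simp) hc), mul_one]
  · exact zero_le

theorem polyaHistogram_mono {N : ℕ} {m m' : ℕ} (h : m ≤ m') {U : Set (Fin (N + 1) → ℕ)}
    (hU : IsUpperSet U) :
    (polyaHistogram N m).toMeasure U ≤ (polyaHistogram N m').toMeasure U := by
  induction m', h using Nat.le_induction with
  | base => exact le_rfl
  | succ k _ ih => exact ih.trans (polyaHistogram_le_succ k hU)

/-! ### A sub-Gaussian bound for the urn -/

/-- Hoeffding's lemma for a Bernoulli variable. -/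
theorem bernoulli_mgf_le {p : ℝ} (hp : p ∈ Set.Icc (0 : ℝ) 1) (s : ℝ) :
    p * Real.exp s + (1 - p) ≤ Real.exp (s * p + s ^ 2 / 8) := by
  let μ : Measure ℝ := ENNReal.ofReal p • Measure.dirac 1 + ENNReal.ofReal (1 - p) • Measure.dirac 0
  have hμ : IsProbabilityMeasure μ := ⟨by
    simp [μ, ← ENNReal.ofReal_add hp.1 (sub_nonneg.2 hp.2)]⟩
  have hint : ∀ f : ℝ → ℝ, ∫ x, f x ∂μ = p * f 1 + (1 - p) * f 0 := by
    intro f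
    have hi : ∀ a : ℝ, Integrable f (Measure.dirac a) := fun a =>
      integrable_dirac (by simp)
    rw [integral_add_measure ((hi 1).smul_measure (by simp)) ((hi 0).smul_measure (by simp)),
      integral_smul_measure, integral_smul_measure, integral_dirac, integral_dirac,
      ENNReal.toReal_ofReal hp.1, ENNReal.toReal_ofReal (sub_nonneg.2 hp.2)]
    simp
  have hb : ∀ᵐ x ∂μ, (id x : ℝ) ∈ Set.Icc (0 : ℝ) 1 := by
    rw [ae_add_measure_iff]
    constructor <;> refine Measure.ae_smul_measure ?_ _ <;>
      refine (ae_dirac_iff (p := fun x => id x ∈ Set.Icc (0 : ℝ) 1) measurableSet_Icc).2 ?_ <;> simp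
  have h := (hasSubgaussianMGF_of_mem_Icc aemeasurable_id hb).mgf_le s
  rw [mgf, hint] at h
  simp only [hint, id] at h
  norm_num at h
  -- The bound `h` concerns the centred variable; the factor `exp (s * p)` undoes the centring.
  have h2 := mul_le_mul_of_nonneg_left h (Real.exp_pos (s * p)).le
  rw [← Real.exp_add] at h2
  calc p * Real.exp s + (1 - p) = Real.exp (s * p) *
        (p * Real.exp (s * (1 - p)) + (1 - p) * Real.exp (-(s * p))) := by
        rw [Real.exp_neg, mul_sub, mul_one, Real.exp_sub]
        field_simp
    _ ≤ _ := h2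
    _ = _ := by congr 1; ring

/-- The proportion of balls with colours in `J` in the urn with histogram of draws `c`. -/
noncomputable def urnProportion {N : ℕ} (J : Finset (Fin (N + 1))) (c : Fin (N + 1) → ℕ) : ℝ :=
  ((J.card : ℝ) + (∑ i ∈ J, c i : ℕ)) / ((N : ℝ) + 1 + (∑ i, c i : ℕ))

/-- One martingale step. With `T` balls in the urn, the next proportion takes two values at distance
`1 / (T + 1)` and its mean is the present proportion, so Hoeffding's lemma applies with parameter `s
/ (T + 1)`. -/
theorem sum_drawColour_mul_exp_le {N : ℕ} (J : Finset (Fin (N + 1))) (c : Fin (N + 1) → ℕ)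
    (s : ℝ) :
    ∑ j, drawColour c j * ENNReal.ofReal (Real.exp (s * urnProportion J (c + Pi.single j 1))) ≤
      ENNReal.ofReal (Real.exp (s * urnProportion J c)) *
        ENNReal.ofReal (Real.exp (s ^ 2 / 8 * (1 / ((N : ℝ) + 1 + (∑ i, c i : ℕ)) -
          1 / ((N : ℝ) + 1 + (∑ i, c i : ℕ) + 1)))) := by
  set T : ℝ := (N : ℝ) + 1 + (∑ i, c i : ℕ) with hT
  have hT0 : 0 < T := by positivity
  set a : ℝ := (J.card : ℝ) + (∑ i ∈ J, c i : ℕ) with ha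
  have ha0 : 0 ≤ a := by positivity
  have hdraw : ∀ j, drawColour c j = ENNReal.ofReal ((1 + c j) / T) := by
    intro j
    rw [drawColour_apply, ENNReal.ofReal_div_of_pos hT0, hT, ← ENNReal.ofReal_natCast,
      ← ENNReal.ofReal_natCast]
    push_cast
    rfl
  have hprop : ∀ j, urnProportion J (c + Pi.single j 1) =
      (a + if j ∈ J then 1 else 0) / (T + 1) := by
    intro j
    rw [urnProportion, sum_add_single, sum_add_single, ha, hT]
    simp [add_assoc]
  have hcard : a ≤ T := by
    rw [ha, hT]
    have h1 : J.card ≤ N + 1 := by simpa using J.card_le_univ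
    have h2 : ∑ i ∈ J, c i ≤ ∑ i, c i := Finset.sum_le_sum_of_subset (Finset.subset_univ _)
    exact_mod_cast add_le_add h1 h2
  have hJ : ∑ j ∈ J, ((1 : ℝ) + c j) / T = a / T := by
    rw [← Finset.sum_div, Finset.sum_add_distrib, ha]
    simp
  have htot : ∑ j, ((1 : ℝ) + c j) / T = 1 := by
    rw [← Finset.sum_div, Finset.sum_add_distrib, hT]
    simp only [Finset.sum_const, Finset.card_univ, Fintype.card_fin, nsmul_eq_mul, mul_one]
    push_cast
    rw [div_self]
    have := hT0.ne'
    rw [hT] at this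
    exact_mod_cast this
  have hJc : ∑ j ∈ Jᶜ, ((1 : ℝ) + c j) / T = 1 - a / T := by
    have := Finset.sum_add_sum_compl J fun j => ((1 : ℝ) + c j) / T
    rw [htot, hJ] at this
    linarith
  simp_rw [hdraw, hprop, ← ENNReal.ofReal_mul (Real.exp_pos _).le]
  rw [Finset.sum_congr rfl fun j _ => (ENNReal.ofReal_mul (by positivity)).symm,
    ← ENNReal.ofReal_sum_of_nonneg (fun j _ => by positivity)]
  refine ENNReal.ofReal_le_ofReal ?_
  rw [← Finset.sum_add_sum_compl J]
  have e1 : ∑ j ∈ J, (1 + (c j : ℝ)) / T * Real.exp (s * ((a + if j ∈ J then 1 else 0) / (T + 1))) =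
      a / T * Real.exp (s * ((a + 1) / (T + 1))) := by
    rw [← hJ, Finset.sum_mul]
    exact Finset.sum_congr rfl fun j hj => by rw [if_pos hj]
  have e2 : ∑ j ∈ Jᶜ, (1 + (c j : ℝ)) / T *
      Real.exp (s * ((a + if j ∈ J then 1 else 0) / (T + 1))) =
      (1 - a / T) * Real.exp (s * (a / (T + 1))) := by
    rw [← hJc, Finset.sum_mul]
    exact Finset.sum_congr rfl fun j hj => by rw [if_neg (Finset.mem_compl.1 hj), add_zero]
  rw [e1, e2]
  have hp : a / T ∈ Set.Icc (0 : ℝ) 1 := ⟨by positivity, (div_le_one hT0).2 hcard⟩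
  have hB := bernoulli_mgf_le hp (s / (T + 1))
  have hprop0 : urnProportion J c = a / T := rfl
  calc a / T * Real.exp (s * ((a + 1) / (T + 1))) + (1 - a / T) * Real.exp (s * (a / (T + 1)))
      = Real.exp (s * (a / (T + 1))) * (a / T * Real.exp (s / (T + 1)) + (1 - a / T)) := by
        rw [show s * ((a + 1) / (T + 1)) = s * (a / (T + 1)) + s / (T + 1) by ring, Real.exp_add]
        ring
    _ ≤ Real.exp (s * (a / (T + 1))) *
        Real.exp (s / (T + 1) * (a / T) + (s / (T + 1)) ^ 2 / 8) := by gcongr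
    _ ≤ _ := by
        rw [← Real.exp_add, ← Real.exp_add, hprop0, Real.exp_le_exp]
        have h1 : s * (a / (T + 1)) + s / (T + 1) * (a / T) = s * (a / T) := by
          field_simp
        -- The squared range is replaced by a difference that telescopes over the draws.
        have h2 : (1 / (T + 1)) ^ 2 ≤ 1 / T - 1 / (T + 1) := by
          rw [div_sub_div _ _ (by positivity) (by positivity), div_pow,
            div_le_div_iff₀ (by positivity) (by positivity)]
          nlinarith
        have h3 := mul_le_mul_of_nonneg_left h2 (show 0 ≤ s ^ 2 / 8 by positivity)
        have h4 : (s / (T + 1)) ^ 2 / 8 = s ^ 2 / 8 * (1 / (T + 1)) ^ 2 := by ring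
        linarith

theorem polyaHistogram_mgf_le {N : ℕ} (J : Finset (Fin (N + 1))) (m : ℕ) (s : ℝ) :
    ∑' c, polyaHistogram N m c * ENNReal.ofReal (Real.exp (s * urnProportion J c)) ≤
      ENNReal.ofReal (Real.exp (s * (J.card / ((N : ℝ) + 1)) +
        s ^ 2 / 8 * (1 / ((N : ℝ) + 1) - 1 / ((N : ℝ) + 1 + m)))) := by
  induction m with
  | zero =>
    rw [tsum_eq_single 0]
    · simp [polyaHistogram, urnProportion]
    · intro c hc
      simp [polyaHistogram, PMF.pure_apply, hc]
  | succ m ih =>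
    rw [tsum_polyaHistogram_succ]
    calc _ ≤ ∑' c, polyaHistogram N m c * ENNReal.ofReal (Real.exp (s * urnProportion J c)) *
          ENNReal.ofReal (Real.exp (s ^ 2 / 8 * (1 / ((N : ℝ) + 1 + m) -
          1 / ((N : ℝ) + 1 + m + 1)))) := by
          refine ENNReal.tsum_le_tsum fun c => ?_
          -- On the support the urn holds exactly `N + 1 + m` balls, so the one-step factor does not
          -- depend on `c`.
          by_cases hc : ∑ i, c i = m
          · have := sum_drawColour_mul_exp_le J c s
            rw [hc] at this
            rw [mul_assoc]
            exact mul_le_mul_right this _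
          · rw [polyaHistogram_apply, if_neg hc]
            simp
      _ ≤ _ := by
          rw [ENNReal.tsum_mul_right]
          refine (mul_le_mul_left ih _).trans ?_
          rw [← ENNReal.ofReal_mul (Real.exp_pos _).le, ← Real.exp_add]
          refine ENNReal.ofReal_le_ofReal (Real.exp_le_exp.2 (le_of_eq ?_))
          push_cast
          rw [← add_assoc ((N : ℝ) + 1)]
          ring

/-- Chernoff's bound for the final urn proportion, whose deviation from its mean is `m / (N + 1 +
m)` times that of the draw frequency; hence the threshold `y`. -/
theorem polyaHistogram_tail_le {N m k : ℕ} (hm : 0 < m) (hkm : k ≤ m) (hkN : k ≤ N + 1)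
    (J : Finset (Fin (N + 1))) {x : ℝ} (hx : 0 ≤ x) :
    (polyaHistogram N m).toMeasure
      {c | x ≤ ((∑ i ∈ J, c i : ℕ) : ℝ) / m - J.card / ((N : ℝ) + 1)} ≤
      ENNReal.ofReal (Real.exp (-(k * x ^ 2))) := by
  classical
  have hm' : (0 : ℝ) < m := by exact_mod_cast hm
  have hN : (0 : ℝ) < (N : ℝ) + 1 := by positivity
  set y : ℝ := m * x / ((N : ℝ) + 1 + m) with hy
  -- This `s` minimises the Chernoff exponent.
  set s : ℝ := 4 * x * ((N : ℝ) + 1) with hs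
  have hs0 : 0 ≤ s := by positivity
  rw [toMeasure_eq_tsum]
  calc _ ≤ ∑' c, polyaHistogram N m c * ENNReal.ofReal (Real.exp (s * urnProportion J c)) *
        ENNReal.ofReal (Real.exp (-(s * (J.card / ((N : ℝ) + 1) + y)))) := by
        refine ENNReal.tsum_le_tsum fun c => ?_
        by_cases hc : ∑ i, c i = m
        · rw [mul_assoc]
          refine mul_le_mul_right ?_ _
          split_ifs with h
          · rw [← ENNReal.ofReal_mul (Real.exp_pos _).le, ← Real.exp_add, ENNReal.one_le_ofReal,
              Real.one_le_exp_iff, ← sub_eq_add_neg, ← mul_sub]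
            refine mul_nonneg hs0 ?_
            have h' : x ≤ ((∑ i ∈ J, c i : ℕ) : ℝ) / m - J.card / ((N : ℝ) + 1) := h
            have e : urnProportion J c - (J.card / ((N : ℝ) + 1) + y) =
                m / ((N : ℝ) + 1 + m) *
                  (((∑ i ∈ J, c i : ℕ) : ℝ) / m - J.card / ((N : ℝ) + 1) - x) := by
              rw [urnProportion, hc, hy]
              field_simp
              ring
            rw [e]
            exact mul_nonneg (by positivity) (sub_nonneg.2 h')
          · exact zero_le
        · rw [polyaHistogram_apply, if_neg hc]
          simp
    _ ≤ _ := by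
        rw [ENNReal.tsum_mul_right]
        refine (mul_le_mul_left (polyaHistogram_mgf_le J m s) _).trans ?_
        rw [← ENNReal.ofReal_mul (Real.exp_pos _).le, ← Real.exp_add]
        refine ENNReal.ofReal_le_ofReal (Real.exp_le_exp.2 ?_)
        have e : s * (J.card / ((N : ℝ) + 1)) +
            s ^ 2 / 8 * (1 / ((N : ℝ) + 1) - 1 / ((N : ℝ) + 1 + m)) +
              -(s * (J.card / ((N : ℝ) + 1) + y)) =
            -(2 * m * ((N : ℝ) + 1) / ((N : ℝ) + 1 + m) * x ^ 2) := by
          rw [hy, hs]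
          field_simp
          ring
        rw [e, neg_le_neg_iff]
        -- The remaining factor is the harmonic mean of `m` and `N + 1`, which is at least their
        -- minimum and so at least `k`.
        refine mul_le_mul_of_nonneg_right ?_ (sq_nonneg x)
        rw [le_div_iff₀ (by positivity)]
        have h1 : (k : ℝ) ≤ m := by exact_mod_cast hkm
        have h2 : (k : ℝ) ≤ (N : ℝ) + 1 := by exact_mod_cast hkN
        nlinarith

/-! ### Quantiles -/

/-- Guards against the default value of `sInf` on a set that is unbounded below. -/
theorem bddBelow_quantile (μ : Measure ℝ) [IsProbabilityMeasure μ] {q : ℝ} (hq : 0 < q) :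
    BddBelow {x : ℝ | q ≤ μ.real (Set.Iic x)} := by
  obtain ⟨b, hb⟩ := ((tendsto_cdf_atBot μ).eventually_lt_const hq).exists
  refine ⟨b, fun x hx => le_of_lt ?_⟩
  have hx' : q ≤ cdf μ x := by rw [cdf_eq_real]; exact hx
  by_contra h
  exact absurd (monotone_cdf μ (not_lt.1 h)) (not_le.2 (hb.trans_le hx'))

theorem quantile_le (μ : Measure ℝ) [IsProbabilityMeasure μ] {q x : ℝ} (hq : 0 < q)
    (hx : q ≤ μ.real (Set.Iic x)) : quantile μ q ≤ x :=
  csInf_le (bddBelow_quantile μ hq) hx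

/-- The infimum is attained because the cdf is right-continuous. -/
theorem le_measureReal_Iic_quantile (μ : Measure ℝ) [IsProbabilityMeasure μ] {q : ℝ}
    (hq : q < 1) : q ≤ μ.real (Set.Iic (quantile μ q)) := by
  have hne : {x : ℝ | q ≤ μ.real (Set.Iic x)}.Nonempty := by
    obtain ⟨b, hb⟩ := ((tendsto_cdf_atTop μ).eventually_const_lt hq).exists
    exact ⟨b, by rw [cdf_eq_real] at hb; exact hb.le⟩
  rw [← cdf_eq_real]
  have hc : Filter.Tendsto (cdf μ) (nhdsWithin (quantile μ q) (Set.Ioi (quantile μ q)))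
      (nhds (cdf μ (quantile μ q))) :=
    ((cdf μ).right_continuous _).mono_left (nhdsWithin_mono _ Set.Ioi_subset_Ici_self)
  refine ge_of_tendsto hc (eventually_nhdsWithin_of_forall fun y hy => ?_)
  obtain ⟨z, hz, hzy⟩ := exists_lt_of_csInf_lt hne hy
  have hz' : q ≤ cdf μ z := by rw [cdf_eq_real]; exact hz
  exact hz'.trans (monotone_cdf μ hzy.le)

/-! ### The supremum deviation -/

instance (m ℓ : ℕ) : IsProbabilityMeasure (universalLaw m ℓ) := by
  unfold universalLaw
  infer_instance

theorem universalLaw_apply (m ℓ : ℕ) {s : Set ℝ} (hs : MeasurableSet s) :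
    universalLaw m ℓ s = (polyaHistogram ℓ m).toMeasure (supDeviation m ⁻¹' s) := by
  rw [universalLaw, PMF.toMeasure_map_apply _ _ _ .of_discrete hs]

/-- The colours whose point of `[0, 1]` is at most `t`. -/
noncomputable def coloursUpTo (N : ℕ) (t : ℝ) : Finset (Fin (N + 1)) :=
  {j | ((j : ℝ) + 1) / ((N : ℝ) + 1) ≤ t}

theorem histCdf_eq {N : ℕ} (m : ℕ) (c : Fin (N + 1) → ℕ) (t : ℝ) :
    histCdf m c t = ((∑ j ∈ coloursUpTo N t, c j : ℕ) : ℝ) / m := by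
  rw [histCdf, coloursUpTo, Finset.sum_filter]
  push_cast
  rfl

theorem card_coloursUpTo_le (N : ℕ) {t : ℝ} (ht : 0 ≤ t) :
    ((coloursUpTo N t).card : ℝ) / ((N : ℝ) + 1) ≤ t := by
  have hN : (0 : ℝ) < (N : ℝ) + 1 := by positivity
  rw [div_le_iff₀ hN]
  refine le_trans ?_ (Nat.floor_le (by positivity : 0 ≤ t * ((N : ℝ) + 1)))
  have : ((coloursUpTo N t).map Fin.valEmbedding).card ≤
      (Finset.range ⌊t * ((N : ℝ) + 1)⌋₊).card := by
    refine Finset.card_le_card fun i hi => ?_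
    obtain ⟨j, hj, rfl⟩ := Finset.mem_map.1 hi
    rw [coloursUpTo, Finset.mem_filter, div_le_iff₀ hN] at hj
    rw [Finset.mem_range, Fin.valEmbedding_apply]
    refine Nat.lt_of_succ_le (Nat.le_floor ?_)
    push_cast
    exact hj.2
  rw [Finset.card_map, Finset.card_range] at this
  exact_mod_cast this

theorem coloursUpTo_mono (N : ℕ) {t u : ℝ} (h : t ≤ u) : coloursUpTo N t ⊆ coloursUpTo N u := by
  intro j hj
  rw [coloursUpTo, Finset.mem_filter] at hj ⊢
  exact ⟨hj.1, hj.2.trans h⟩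

/-- These sets are initial segments of the colours, so only `N + 2` of them occur as `t` varies;
this makes the union bound finite when `N ≤ m`. -/
theorem coloursUpTo_card (N : ℕ) (t : ℝ) :
    coloursUpTo N t = Finset.univ.filter fun j : Fin (N + 1) => (j : ℕ) < (coloursUpTo N t).card := by
  have hlower : ∀ i j : Fin (N + 1), i ≤ j → j ∈ coloursUpTo N t → i ∈ coloursUpTo N t := by
    intro i j hij hj
    rw [coloursUpTo, Finset.mem_filter] at hj ⊢
    refine ⟨Finset.mem_univ _, le_trans ?_ hj.2⟩
    have : (i : ℝ) ≤ j := by exact_mod_cast hij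
    gcongr
  ext j
  rw [Finset.mem_filter]
  constructor
  · intro hj
    refine ⟨Finset.mem_univ _, ?_⟩
    have : Finset.Iic j ⊆ coloursUpTo N t := fun i hi => hlower i j (Finset.mem_Iic.1 hi) hj
    have := Finset.card_le_card this
    rw [Fin.card_Iic] at this
    omega
  · rintro ⟨-, hj⟩
    by_contra h
    have : coloursUpTo N t ⊆ Finset.Iio j := fun i hi => by
      rw [Finset.mem_Iio]
      by_contra hij
      exact h (hlower j i (not_lt.1 hij) hi)
    have := Finset.card_le_card this
    rw [Fin.card_Iio] at this
    omega

theorem histCdf_sub_le_supDeviation {N : ℕ} (m : ℕ) (c : Fin (N + 1) → ℕ) {t : ℝ}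
    (ht : t ∈ Set.Icc (0 : ℝ) 1) : histCdf m c t - t ≤ supDeviation m c := by
  refine le_ciSup (f := fun t : Set.Icc (0 : ℝ) 1 => histCdf m c t - t)
    ⟨((∑ j, c j : ℕ) : ℝ) / m, ?_⟩ ⟨t, ht⟩
  rintro _ ⟨u, rfl⟩
  have h1 : histCdf m c u ≤ ((∑ j, c j : ℕ) : ℝ) / m := by
    rw [histCdf_eq]
    have := Finset.sum_le_sum_of_subset (f := c) (Finset.subset_univ (coloursUpTo N u))
    gcongr
  have := u.2.1
  show histCdf m c u - u ≤ _
  linarith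

theorem polyaHistogram_sum_ne (N m : ℕ) :
    (polyaHistogram N m).toMeasure {c | ∑ i, c i ≠ m} = 0 := by
  classical
  rw [toMeasure_eq_tsum, ENNReal.tsum_eq_zero]
  intro c
  rw [polyaHistogram_apply]
  by_cases h : ∑ i, c i = m <;> simp [h]

theorem supDeviation_tail_le_of_cover {N m k n : ℕ} (hm : 0 < m) (hkm : k ≤ m) (hkN : k ≤ N + 1)
    {x : ℝ} (hx : 0 ≤ x) (J : ℕ → Finset (Fin (N + 1)))
    (hJ : ∀ c : Fin (N + 1) → ℕ, ∑ i, c i = m → x < supDeviation m c →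
      ∃ i < n, x ≤ ((∑ j ∈ J i, c j : ℕ) : ℝ) / m - (J i).card / ((N : ℝ) + 1)) :
    (polyaHistogram N m).toMeasure {c | x < supDeviation m c} ≤
      n * ENNReal.ofReal (Real.exp (-(k * x ^ 2))) := by
  have hsub : {c | x < supDeviation m c} ⊆ {c : Fin (N + 1) → ℕ | ∑ i, c i ≠ m} ∪
      ⋃ i ∈ Finset.range n,
        {c | x ≤ ((∑ j ∈ J i, c j : ℕ) : ℝ) / m - (J i).card / ((N : ℝ) + 1)} := by
    intro c hc
    by_cases hs : ∑ i, c i = m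
    · obtain ⟨i, hi, h⟩ := hJ c hs hc
      exact Or.inr (Set.mem_biUnion (Finset.mem_coe.2 (Finset.mem_range.2 hi)) h)
    · exact Or.inl hs
  refine (measure_mono hsub).trans ((measure_union_le _ _).trans ?_)
  rw [polyaHistogram_sum_ne, zero_add]
  refine (measure_biUnion_finset_le _ _).trans ?_
  refine (Finset.sum_le_sum fun i _ => polyaHistogram_tail_le hm hkm hkN (J i) hx).trans ?_
  simp

theorem supDeviation_tail_le {N m : ℕ} (hm : 0 < m) {x : ℝ} (hx : 0 ≤ x) :
    (polyaHistogram N m).toMeasure {c | x < supDeviation m c} ≤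
      (min m N + 2 : ℕ) * ENNReal.ofReal (Real.exp (-((min m N : ℕ) * x ^ 2))) := by
  have hm' : (0 : ℝ) < m := by exact_mod_cast hm
  have hex : ∀ c : Fin (N + 1) → ℕ, x < supDeviation m c →
      ∃ t : ℝ, 0 ≤ t ∧ x < ((∑ j ∈ coloursUpTo N t, c j : ℕ) : ℝ) / m - t := by
    intro c hc
    obtain ⟨t, ht⟩ := exists_lt_of_lt_ciSup hc
    exact ⟨t, t.2.1, by rwa [histCdf_eq] at ht⟩
  rcases le_total m N with h | h
  · rw [min_eq_left h]
    -- With few draws, index by the cumulative count `i ≤ m`. A deviation above `x` at `t` forces `t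
    -- < i / m - x`. Moving `t` up to that value keeps the count at least `i`, and the deviation
    -- there is still at least `x`.
    refine supDeviation_tail_le_of_cover hm le_rfl (by omega) hx
      (fun i => coloursUpTo N ((i : ℝ) / m - x)) fun c hs hc => ?_
    obtain ⟨t, ht0, ht⟩ := hex c hc
    set i := ∑ j ∈ coloursUpTo N t, c j with hi
    have him : i ≤ m := by
      rw [← hs]
      exact Finset.sum_le_sum_of_subset (Finset.subset_univ _)
    refine ⟨i, by omega, ?_⟩
    have htu : t ≤ (i : ℝ) / m - x := by linarith
    have h1 : (i : ℝ) / m ≤ ((∑ j ∈ coloursUpTo N ((i : ℝ) / m - x), c j : ℕ) : ℝ) / m := by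
      have : i ≤ ∑ j ∈ coloursUpTo N ((i : ℝ) / m - x), c j :=
        Finset.sum_le_sum_of_subset (coloursUpTo_mono N htu)
      gcongr
    have h2 := card_coloursUpTo_le N (ht0.trans htu)
    linarith
  · rw [min_eq_right h]
    -- With few colours, index by the length `0, …, N + 1` of the initial segment.
    refine supDeviation_tail_le_of_cover hm h (by omega) hx
      (fun i => Finset.univ.filter fun j => (j : ℕ) < i) fun c _ hc => ?_
    obtain ⟨t, ht0, ht⟩ := hex c hc
    refine ⟨(coloursUpTo N t).card, ?_, ?_⟩
    · have := (coloursUpTo N t).card_le_univ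
      rw [Fintype.card_fin] at this
      omega
    · rw [← coloursUpTo_card]
      have := card_coloursUpTo_le N ht0
      linarith

theorem one_sub_le_universalLaw {m ℓ : ℕ} {δ x : ℝ} (hδ : 0 ≤ δ)
    (h : (polyaHistogram ℓ m).toMeasure {c | x < supDeviation m c} ≤ ENNReal.ofReal δ) :
    1 - δ ≤ (universalLaw m ℓ).real (Set.Iic x) := by
  have h1 : (universalLaw m ℓ) (Set.Iic x)ᶜ ≤ ENNReal.ofReal δ := by
    rw [universalLaw_apply _ _ measurableSet_Iic.compl]
    simpa [Set.preimage, Set.compl_Iic] using h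
  have h2 := ENNReal.toReal_le_of_le_ofReal hδ h1
  have h3 := probReal_compl_eq_one_sub (μ := universalLaw m ℓ) (measurableSet_Iic (a := x))
  rw [measureReal_def] at h3
  linarith

/-- The probability that the supremum deviation exceeds its `(1 - δ)`-quantile. -/
theorem polyaHistogram_lam_lt_le (m ℓ : ℕ) {δ : ℝ} (hδ : δ ∈ Set.Ioo (0 : ℝ) 1) :
    (polyaHistogram ℓ m).toMeasure {c | lam m ℓ δ < supDeviation m c} ≤ ENNReal.ofReal δ := by
  have h := le_measureReal_Iic_quantile (universalLaw m ℓ) (q := 1 - δ) (by linarith [hδ.1])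
  have h3 := probReal_compl_eq_one_sub (μ := universalLaw m ℓ)
    (measurableSet_Iic (a := quantile (universalLaw m ℓ) (1 - δ)))
  have e : (polyaHistogram ℓ m).toMeasure {c | lam m ℓ δ < supDeviation m c} =
      universalLaw m ℓ (Set.Iic (quantile (universalLaw m ℓ) (1 - δ)))ᶜ := by
    rw [universalLaw_apply _ _ measurableSet_Iic.compl]
    simp [Set.preimage, Set.compl_Iic, lam]
  rw [e, ← ofReal_measureReal]
  exact ENNReal.ofReal_le_ofReal (by linarith)

theorem lam_le_sqrt {m ℓ : ℕ} (hm : 1 ≤ m) (hℓ : 1 ≤ ℓ) {δ : ℝ} (hδ : δ ∈ Set.Ioo (0 : ℝ) 1) :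
    lam m ℓ δ ≤ Real.sqrt ((Real.log δ⁻¹ +
      Real.log (1 + 2 * Real.sqrt Real.pi * (min m ℓ : ℕ))) / (min m ℓ : ℕ)) := by
  set k := min m ℓ with hk
  have hk1 : (1 : ℝ) ≤ k := by exact_mod_cast le_min hm hℓ
  set B : ℝ := 1 + 2 * Real.sqrt Real.pi * k with hB
  have hpi : 1 ≤ Real.sqrt Real.pi := Real.one_le_sqrt.2 (by linarith [Real.pi_gt_three])
  -- `k + 2` bounds the number of events in the union bound; at the chosen threshold each has
  -- probability at most `δ / B`.
  have hkB : (k : ℝ) + 2 ≤ B := by nlinarith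
  have hlog : 0 ≤ Real.log δ⁻¹ + Real.log B :=
    add_nonneg (Real.log_nonneg ((one_le_inv₀ hδ.1).2 hδ.2.le)) (Real.log_nonneg (by linarith))
  refine quantile_le _ (by linarith [hδ.2]) (one_sub_le_universalLaw hδ.1.le ?_)
  refine (supDeviation_tail_le hm (Real.sqrt_nonneg _)).trans ?_
  rw [← hk, Real.sq_sqrt (by positivity), mul_div_cancel₀ _ (by positivity), Real.exp_neg,
    Real.exp_add, Real.exp_log (inv_pos.2 hδ.1), Real.exp_log (by linarith),
    ← ENNReal.ofReal_natCast, ← ENNReal.ofReal_mul (by positivity)]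
  refine ENNReal.ofReal_le_ofReal ?_
  rw [mul_inv, inv_inv]
  push_cast
  have hB0 : 0 < B := by linarith
  rw [mul_comm δ, ← mul_assoc, ← div_eq_mul_inv]
  exact mul_le_of_le_one_left hδ.1.le ((div_le_one hB0).2 hkB)

/-! ### Ranks of the complement of a uniform subset -/

section Ranks

variable {α : Type*} [DecidableEq α]

/-- The histogram of the ranks of the elements of `W \ D` among the elements of `D`, with respect to
the scores `S`. -/
noncomputable def rankHistogram (N : ℕ) (S : α → ℝ) (W D : Finset α) : Fin (N + 1) → ℕ :=
  fun j => {e ∈ W \ D | {f ∈ D | S e ≤ S f}.card = (j : ℕ)}.card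

theorem sum_rankHistogram {N : ℕ} (S : α → ℝ) (W : Finset α) {D : Finset α} (hD : D.card = N)
    (p : ℕ → Prop) [DecidablePred p] :
    ∑ j : Fin (N + 1), (if p j then rankHistogram N S W D j else 0) =
      {e ∈ W \ D | p {f ∈ D | S e ≤ S f}.card}.card := by
  have hlt : ∀ e, {f ∈ D | S e ≤ S f}.card < N + 1 := fun e =>
    Nat.lt_succ_of_le (hD ▸ Finset.card_filter_le _ _)
  rw [Finset.card_eq_sum_card_fiberwise (t := Finset.univ)
    (f := fun e => (⟨{f ∈ D | S e ≤ S f}.card, hlt e⟩ : Fin (N + 1)))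
    (fun _ _ => Finset.mem_coe.2 (Finset.mem_univ _))]
  refine Finset.sum_congr rfl fun j _ => ?_
  rw [Finset.filter_filter]
  split_ifs with hj
  · rw [rankHistogram]
    congr 1
    refine Finset.filter_congr fun e _ => ?_
    rw [Fin.ext_iff]
    constructor
    · intro h
      exact ⟨by simpa only [h] using hj, h⟩
    · exact fun h => h.2
  · symm
    rw [Finset.card_eq_zero, Finset.filter_eq_empty_iff]
    rintro e - ⟨h1, h2⟩
    rw [Fin.ext_iff] at h2
    exact hj (by simpa only [← h2] using h1)

theorem sum_rankHistogram_univ {N : ℕ} (S : α → ℝ) (W : Finset α) {D : Finset α}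
    (hD : D.card = N) : ∑ j, rankHistogram N S W D j = (W \ D).card := by
  simpa using sum_rankHistogram S W hD (fun _ => True)

/-- Take as cutoff the number of elements of `D` above `w`. An element of `W \ D` at or below `w`
has a larger rank, because `w` itself is counted. So the left side counts only elements above `w`,
which count on the right as well, together with `w`. -/
theorem card_filter_lt_of_agree_above {S : α → ℝ} {W D D' : Finset α} {w : α}
    (hD : D ⊆ W) (hD' : D' ⊆ W) (hS : Set.InjOn S W) (hw : w ∈ D) (hw' : w ∉ D')
    (hagree : ∀ e, S w < S e → (e ∈ D ↔ e ∈ D')) :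
    {e ∈ W \ D | {f ∈ D | S e ≤ S f}.card ≤ {f ∈ D | S w < S f}.card}.card <
      {e ∈ W \ D' | {f ∈ D' | S e ≤ S f}.card ≤ {f ∈ D | S w < S f}.card}.card := by
  refine Finset.card_lt_card ((Finset.ssubset_iff_of_subset ?_).2 ⟨w, ?_, ?_⟩)
  · intro e he
    rw [Finset.mem_filter, Finset.mem_sdiff] at he ⊢
    obtain ⟨⟨heW, heD⟩, hcount⟩ := he
    have hlt : S w < S e := by
      by_contra hle
      have hsub : insert w {f ∈ D | S w < S f} ⊆ {f ∈ D | S e ≤ S f} := by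
        intro f hf
        rw [Finset.mem_insert, Finset.mem_filter] at hf
        rw [Finset.mem_filter]
        rcases hf with rfl | ⟨hf, h⟩
        · exact ⟨hw, not_lt.1 hle⟩
        · exact ⟨hf, (not_lt.1 hle).trans h.le⟩
      have := Finset.card_le_card hsub
      rw [Finset.card_insert_of_notMem (by simp)] at this
      omega
    refine ⟨⟨heW, fun h => heD ((hagree e hlt).2 h)⟩, Finset.card_le_card fun f hf => ?_⟩
    rw [Finset.mem_filter] at hf ⊢
    have hf' := hlt.trans_le hf.2
    exact ⟨(hagree f hf').2 hf.1, hf'⟩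
  · rw [Finset.mem_filter, Finset.mem_sdiff]
    refine ⟨⟨hD hw, hw'⟩, Finset.card_le_card fun f hf => ?_⟩
    rw [Finset.mem_filter] at hf ⊢
    have hf' : S w < S f := lt_of_le_of_ne hf.2 fun h =>
      hw' (hS (hD hw) (hD' hf.1) h ▸ hf.1)
    exact ⟨(hagree f hf').2 hf.1, hf'⟩
  · simp [hw]

/-- Two different subsets differ at some element of highest score, and the cumulative rank counts
already tell them apart there. -/
theorem injOn_rankHistogram {N : ℕ} {S : α → ℝ} {W : Finset α} (hS : Set.InjOn S W) :
    Set.InjOn (rankHistogram N S W) (W.powersetCard N) := by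
  intro D hD D' hD' h
  rw [Finset.mem_coe, Finset.mem_powersetCard] at hD hD'
  by_contra hne
  have hcum : ∀ k, {e ∈ W \ D | {f ∈ D | S e ≤ S f}.card ≤ k}.card =
      {e ∈ W \ D' | {f ∈ D' | S e ≤ S f}.card ≤ k}.card := by
    intro k
    rw [← sum_rankHistogram S W hD.2 (fun i => i ≤ k), h,
      sum_rankHistogram S W hD'.2 (fun i => i ≤ k)]
  have hsd : (symmDiff D D').Nonempty := by
    rw [Finset.nonempty_iff_ne_empty]
    intro h0
    exact hne (symmDiff_eq_bot.1 h0)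
  obtain ⟨w, hw, hmax⟩ := Finset.exists_max_image _ S hsd
  have hagree : ∀ e, S w < S e → (e ∈ D ↔ e ∈ D') := by
    intro e he
    by_contra hcon
    refine absurd (hmax e ?_) (not_le.2 he)
    rw [Finset.mem_symmDiff]
    tauto
  rcases Finset.mem_symmDiff.1 hw with ⟨h1, h2⟩ | ⟨h1, h2⟩
  · exact absurd (hcum _) (card_filter_lt_of_agree_above hD.1 hD'.1 hS h1 h2 hagree).ne
  · exact absurd (hcum _) (card_filter_lt_of_agree_above hD'.1 hD.1 hS h1 h2
      fun e he => (hagree e he).symm).ne'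

/-- Distinct subsets give distinct histograms, and each of these has urn probability `1 /
W.card.choose N`. -/
theorem card_filter_rankHistogram_le {N : ℕ} {S : α → ℝ} {W : Finset α} (hS : Set.InjOn S W)
    (hN : N ≤ W.card) (U : Set (Fin (N + 1) → ℕ)) [DecidablePred (· ∈ U)] :
    ({D ∈ W.powersetCard N | rankHistogram N S W D ∈ U}.card : ℝ≥0∞) ≤
      (polyaHistogram N (W.card - N)).toMeasure U * (W.card.choose N : ℕ) := by
  set F := {D ∈ W.powersetCard N | rankHistogram N S W D ∈ U} with hF
  have hsub : ((F.image (rankHistogram N S W) : Finset _) : Set (Fin (N + 1) → ℕ)) ⊆ U := by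
    intro c hc
    obtain ⟨D, hD, rfl⟩ := Finset.mem_image.1 (Finset.mem_coe.1 hc)
    exact (Finset.mem_filter.1 hD).2
  refine le_trans ?_ (mul_le_mul_left (measure_mono hsub) _)
  rw [PMF.toMeasure_apply_finset, Finset.sum_image fun D hD D' hD' h =>
    injOn_rankHistogram hS (Finset.mem_coe.2 (Finset.mem_filter.1 hD).1)
      (Finset.mem_coe.2 (Finset.mem_filter.1 hD').1) h]
  have hval : ∀ D ∈ F, polyaHistogram N (W.card - N) (rankHistogram N S W D) =
      ((W.card.choose N : ℕ) : ℝ≥0∞)⁻¹ := by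
    intro D hD
    have hD' := Finset.mem_powersetCard.1 (Finset.mem_filter.1 hD).1
    rw [polyaHistogram_apply, if_pos, Nat.sub_add_cancel hN]
    rw [sum_rankHistogram_univ S W hD'.2, Finset.card_sdiff_of_subset hD'.1, hD'.2]
  rw [Finset.sum_congr rfl hval, Finset.sum_const, nsmul_eq_mul, mul_assoc,
    ENNReal.inv_mul_cancel, mul_one]
  · exact_mod_cast (Nat.choose_pos hN).ne'
  · exact ENNReal.natCast_ne_top _

end Ranks

/-! ### Exceedance probabilities for a uniform subset -/

/-- The histograms whose cumulative counts exceed `m * (t + lam m N δ)` for some `t`. -/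
def exceedSet (N m : ℕ) (δ : ℝ) : Set (Fin (N + 1) → ℕ) :=
  {c | ∃ t ∈ Set.Icc (0 : ℝ) 1, (m : ℝ) * (t + lam m N δ) <
    ((∑ j ∈ coloursUpTo N t, c j : ℕ) : ℝ)}

theorem isUpperSet_exceedSet (N m : ℕ) (δ : ℝ) : IsUpperSet (exceedSet N m δ) := by
  rintro c c' hcc ⟨t, ht, h⟩
  refine ⟨t, ht, h.trans_le ?_⟩
  exact_mod_cast Finset.sum_le_sum fun j _ => hcc j

theorem polyaHistogram_exceedSet_le (N m : ℕ) {δ : ℝ} (hδ : δ ∈ Set.Ioo (0 : ℝ) 1) :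
    (polyaHistogram N m).toMeasure (exceedSet N m δ) ≤ ENNReal.ofReal δ := by
  have hsub : exceedSet N m δ ⊆
      {c | ∑ i, c i ≠ m} ∪ {c | lam m N δ < supDeviation m c} := by
    rintro c ⟨t, ht, h⟩
    by_cases hs : ∑ i, c i = m
    · right
      -- Without draws, dividing by `m` is meaningless, but then all counts vanish and nothing can
      -- exceed.
      rcases Nat.eq_zero_or_pos m with rfl | hm
      · have h0 := Finset.sum_le_sum_of_subset (f := c) (Finset.subset_univ (coloursUpTo N t))
        rw [hs, Nat.le_zero] at h0
        rw [h0] at h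
        simp at h
      · have hm' : (0 : ℝ) < m := by exact_mod_cast hm
        refine lt_of_lt_of_le ?_ (histCdf_sub_le_supDeviation m c ht)
        rw [lt_sub_iff_add_lt', histCdf_eq, lt_div_iff₀ hm', mul_comm]
        exact h
    · exact Or.inl hs
  refine (measure_mono hsub).trans ((measure_union_le _ _).trans ?_)
  rw [polyaHistogram_sum_ne, zero_add]
  exact polyaHistogram_lam_lt_le m N hδ

theorem pValue_eq {n : ℕ} (S : Fin n × Fin n → ℝ) (D : Finset (Fin n × Fin n))
    (e : Fin n × Fin n) :
    pValue S D e = (({f ∈ D | S e ≤ S f}.card : ℝ) + 1) / ((D.card : ℝ) + 1) := by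
  rw [pValue, Finset.sum_boole, add_comm]

/-- Among the subsets `D` of `W` of a given size, at most a proportion `δ` leads to too many small
p-values in `W \ D`. -/
theorem card_filter_exceed_le {n N m : ℕ} {S : Fin n × Fin n → ℝ} {W : Finset (Fin n × Fin n)}
    (hS : Set.InjOn S W) (hN : N ≤ W.card) (hm : W.card - N ≤ m) {δ : ℝ}
    (hδ : δ ∈ Set.Ioo (0 : ℝ) 1)
    [DecidablePred fun D : Finset (Fin n × Fin n) => ∃ t ∈ Set.Icc (0 : ℝ) 1,
      (m : ℝ) * (t + lam m N δ) < ({e ∈ W \ D | pValue S D e ≤ t}.card : ℝ)] :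
    ({D ∈ W.powersetCard N | ∃ t ∈ Set.Icc (0 : ℝ) 1,
      (m : ℝ) * (t + lam m N δ) < ({e ∈ W \ D | pValue S D e ≤ t}.card : ℝ)}.card : ℝ) ≤
      δ * (W.card.choose N : ℕ) := by
  classical
  -- The urn is run for `m` draws in place of `W.card - N`, which only increases the probability of
  -- an upper set.
  have h := (card_filter_rankHistogram_le hS hN (exceedSet N m δ)).trans
    (mul_le_mul_left ((polyaHistogram_mono hm (isUpperSet_exceedSet N m δ)).trans
      (polyaHistogram_exceedSet_le N m hδ)) _)
  rw [← ENNReal.ofReal_natCast, ← ENNReal.ofReal_natCast, ← ENNReal.ofReal_mul hδ.1.le,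
    ENNReal.ofReal_le_ofReal_iff (mul_nonneg hδ.1.le (Nat.cast_nonneg _))] at h
  refine le_trans (le_of_eq ?_) h
  norm_cast
  congr 1
  refine Finset.filter_congr fun D hD => ?_
  have hcard := (Finset.mem_powersetCard.1 hD).2
  have hcount : ∀ t : ℝ, ∑ j ∈ coloursUpTo N t, rankHistogram N S W D j =
      {e ∈ W \ D | pValue S D e ≤ t}.card := by
    intro t
    rw [coloursUpTo, Finset.sum_filter,
      sum_rankHistogram S W hcard fun i => ((i : ℝ) + 1) / ((N : ℝ) + 1) ≤ t]
    simp_rw [pValue_eq, hcard]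
  simp only [exceedSet, Set.mem_ofPred_eq, hcount]

/-! ### The sampling and calibration weights -/

section Weights

variable {n : ℕ}

/-- The conditional probability of the sampling matrix `o` given the adjacency matrix `a`. -/
def sampleWeight (w₀ w₁ : ℝ) (a o : BMat n) : ℝ :=
  ∏ i, ∏ j, sampleProb w₀ w₁ (a i j) (o i j)

/-- The conditional probability of the calibration set `D` given `a` and `o`. -/
noncomputable def calWeight (L : ℕ → Finset (Fin n × Fin n) → ℕ) (a o : BMat n)
    (D : Finset (Fin n × Fin n)) : ℝ :=
  if D ∈ (obsFalse a o).powersetCard (calSize L a o)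
  then (((obsFalse a o).card.choose (calSize L a o) : ℕ) : ℝ)⁻¹ else 0

/-- The conditional probability of `(o, D)` given `a`. -/
noncomputable def pairWeight (w₀ w₁ : ℝ) (L : ℕ → Finset (Fin n × Fin n) → ℕ) (a : BMat n)
    (p : BMat n × Finset (Fin n × Fin n)) : ℝ :=
  sampleWeight w₀ w₁ a p.1 * calWeight L a p.1 p.2

theorem sampleWeight_eq (w₀ w₁ : ℝ) (a o : BMat n) :
    sampleWeight w₀ w₁ a o = w₀ ^ (obsFalse a o).card * (1 - w₀) ^ (nullSet a o).card *
      (w₁ ^ (obsTrue a o).card * (1 - w₁) ^ (testSet o \ nullSet a o).card) := by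
  have hsd : testSet o \ nullSet a o =
      Finset.univ.filter fun e => o e.1 e.2 = false ∧ a e.1 e.2 = true := by
    ext e
    cases h1 : o e.1 e.2 <;> cases h2 : a e.1 e.2 <;> simp [testSet, nullSet, h1, h2]
  rw [sampleWeight, ← Fintype.prod_prod_type' (fun i j => sampleProb w₀ w₁ (a i j) (o i j)), hsd,
    obsFalse, nullSet, obsTrue]
  simp_rw [← Finset.prod_const, Finset.prod_filter, ← Finset.prod_mul_distrib]
  refine Finset.prod_congr rfl fun e _ => ?_
  cases h1 : o e.1 e.2 <;> cases h2 : a e.1 e.2 <;> simp [sampleProb]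

theorem sampleWeight_nonneg {w₀ w₁ : ℝ} (hw₀ : w₀ ∈ Set.Icc (0 : ℝ) 1)
    (hw₁ : w₁ ∈ Set.Icc (0 : ℝ) 1) (a o : BMat n) : 0 ≤ sampleWeight w₀ w₁ a o := by
  have h0 := sub_nonneg.2 hw₀.2
  have h1 := sub_nonneg.2 hw₁.2
  have h2 := hw₀.1
  have h3 := hw₁.1
  rw [sampleWeight_eq]
  positivity

theorem calWeight_nonneg (L : ℕ → Finset (Fin n × Fin n) → ℕ) (a o : BMat n)
    (D : Finset (Fin n × Fin n)) : 0 ≤ calWeight L a o D := by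
  rw [calWeight]
  positivity

theorem pairWeight_nonneg {w₀ w₁ : ℝ} (hw₀ : w₀ ∈ Set.Icc (0 : ℝ) 1)
    (hw₁ : w₁ ∈ Set.Icc (0 : ℝ) 1) (L : ℕ → Finset (Fin n × Fin n) → ℕ) (a : BMat n)
    (p : BMat n × Finset (Fin n × Fin n)) : 0 ≤ pairWeight w₀ w₁ L a p :=
  mul_nonneg (sampleWeight_nonneg hw₀ hw₁ _ _) (calWeight_nonneg _ _ _ _)

/-- The sampling matrix with training matrix `τ` and calibration set `D`. -/
def unmask (τ : BMat n) (D : Finset (Fin n × Fin n)) : BMat n :=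
  fun i j => τ i j || decide ((i, j) ∈ D)

theorem unmask_trainMask {a o : BMat n} {D : Finset (Fin n × Fin n)} (hD : D ⊆ obsFalse a o) :
    unmask (trainMask o D) D = o := by
  funext i j
  by_cases h : (i, j) ∈ D
  · have := hD h
    simp only [obsFalse, Finset.mem_filter] at this
    simp [unmask, h, this.2.1]
  · simp [unmask, trainMask, h]

theorem subset_nullSet_trainMask {a o : BMat n} {D : Finset (Fin n × Fin n)}
    (hD : D ⊆ obsFalse a o) : D ⊆ nullSet a (trainMask o D) := by
  intro e he
  have := hD he
  simp only [obsFalse, Finset.mem_filter] at this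
  simp [nullSet, trainMask, he, this.2.2]

section

variable {a τ : BMat n} {D : Finset (Fin n × Fin n)}

theorem of_mem_nullSet_subset (hD : D ⊆ nullSet a τ) {i j : Fin n} (h : (i, j) ∈ D) :
    τ i j = false ∧ a i j = false := by
  have := hD h
  simpa [nullSet] using this

theorem trainMask_unmask (hD : D ⊆ nullSet a τ) : trainMask (unmask τ D) D = τ := by
  funext i j
  by_cases h : (i, j) ∈ D
  · simp [trainMask, h, (of_mem_nullSet_subset hD h).1]
  · simp [trainMask, unmask, h]

theorem observed_unmask (hD : D ⊆ nullSet a τ) : observed a (unmask τ D) = observed a τ := by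
  funext i j
  by_cases h : (i, j) ∈ D
  · simp [observed, (of_mem_nullSet_subset hD h).2]
  · simp [observed, unmask, h]

theorem obsTrue_unmask (hD : D ⊆ nullSet a τ) : obsTrue a (unmask τ D) = obsTrue a τ := by
  ext ⟨i, j⟩
  by_cases h : (i, j) ∈ D
  · simp [obsTrue, (of_mem_nullSet_subset hD h).2]
  · simp [obsTrue, unmask, h]

theorem nullSet_unmask : nullSet a (unmask τ D) = nullSet a τ \ D := by
  ext ⟨i, j⟩
  by_cases h : (i, j) ∈ D <;> simp [nullSet, unmask, h]

theorem testSet_unmask : testSet (unmask τ D) = testSet τ \ D := by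
  ext ⟨i, j⟩
  by_cases h : (i, j) ∈ D <;> simp [testSet, unmask, h]

theorem obsFalse_unmask (hD : D ⊆ nullSet a τ) : obsFalse a (unmask τ D) = obsFalse a τ ∪ D := by
  ext ⟨i, j⟩
  by_cases h : (i, j) ∈ D
  · simp [obsFalse, unmask, h, (of_mem_nullSet_subset hD h).2]
  · simp [obsFalse, unmask, h]

theorem card_obsFalse_unmask (hD : D ⊆ nullSet a τ) :
    (obsFalse a (unmask τ D)).card = (obsFalse a τ).card + D.card := by
  rw [obsFalse_unmask hD, Finset.card_union_of_disjoint]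
  rw [Finset.disjoint_left]
  rintro ⟨i, j⟩ h hj
  simp [obsFalse, (of_mem_nullSet_subset hD hj).1] at h

/-- Once `τ` is fixed, `D` enters only through its size: this is the exchangeability of the hidden
false edges. -/
theorem sampleWeight_unmask (hD : D ⊆ nullSet a τ) (w₀ w₁ : ℝ) :
    sampleWeight w₀ w₁ a (unmask τ D) =
    w₀ ^ ((obsFalse a τ).card + D.card) * (1 - w₀) ^ ((nullSet a τ).card - D.card) *
      (w₁ ^ (obsTrue a τ).card * (1 - w₁) ^ (testSet τ \ nullSet a τ).card) := by
  have h : testSet (unmask τ D) \ nullSet a (unmask τ D) = testSet τ \ nullSet a τ := by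
    rw [nullSet_unmask, testSet_unmask]
    ext e
    have := @hD e
    simp only [Finset.mem_sdiff]
    tauto
  rw [sampleWeight_eq, h, card_obsFalse_unmask hD, nullSet_unmask, obsTrue_unmask hD,
    Finset.card_sdiff_of_subset hD]

theorem score_unmask (hD : D ⊆ nullSet a τ) {d : ℕ}
    (g : Obs n d → RMat n n) (x : RMat n d) :
    score g a x (unmask τ D) D = fun e => g (observed a τ, x, τ) e.1 e.2 := by
  funext e
  rw [score, observed_unmask hD, trainMask_unmask hD]

end

/-- The admissible pairs of a sampling matrix and a calibration set. -/
def admissible (L : ℕ → Finset (Fin n × Fin n) → ℕ) (a : BMat n) :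
    Finset (BMat n × Finset (Fin n × Fin n)) :=
  {p | p.2 ∈ (obsFalse a p.1).powersetCard (calSize L a p.1)}

theorem pairWeight_of_notMem (w₀ w₁ : ℝ) {L : ℕ → Finset (Fin n × Fin n) → ℕ} {a : BMat n}
    {p : BMat n × Finset (Fin n × Fin n)} (hp : p ∉ admissible L a) :
    pairWeight w₀ w₁ L a p = 0 := by
  rw [pairWeight, calWeight, if_neg, mul_zero]
  simpa [admissible] using hp

/-- The information on `(o, D)` given which `D` is uniform on a family of sets. -/
def maskAndCount (a : BMat n) (p : BMat n × Finset (Fin n × Fin n)) : BMat n × ℕ :=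
  (trainMask p.1 p.2, (obsFalse a p.1).card)

/-- The mask `τ` determines `D¹` but not `|D⁰|`, on which the calibration size also depends. Fixing
`k` as well pins down that size, and the fibre becomes a full family of subsets. -/
theorem filter_maskAndCount_eq {L : ℕ → Finset (Fin n × Fin n) → ℕ} {a : BMat n} {τ : BMat n}
    {k : ℕ} (hk : (obsFalse a τ).card + L k (obsTrue a τ) = k) :
    {p ∈ admissible L a | maskAndCount a p = (τ, k)} =
      ((nullSet a τ).powersetCard (L k (obsTrue a τ))).image fun D => (unmask τ D, D) := by
  ext ⟨o, D⟩
  simp only [admissible, maskAndCount, Finset.mem_filter, Finset.mem_univ, true_and,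
    Finset.mem_powersetCard, Finset.mem_image, Prod.mk.injEq, calSize]
  constructor
  · rintro ⟨⟨hD, hcard⟩, rfl, rfl⟩
    have h1 := subset_nullSet_trainMask hD
    have h2 := unmask_trainMask hD
    have h3 := obsTrue_unmask h1
    rw [h2] at h3
    exact ⟨D, ⟨h1, by rw [hcard, h3]⟩, h2, rfl⟩
  · rintro ⟨D', ⟨hD, hcard⟩, rfl, rfl⟩
    have h1 : (obsFalse a (unmask τ D')).card = k := by
      rw [card_obsFalse_unmask hD, hcard, hk]
    refine ⟨⟨?_, ?_⟩, trainMask_unmask hD, h1⟩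
    · rw [obsFalse_unmask hD]
      exact Finset.subset_union_right
    · rw [h1, obsTrue_unmask hD, hcard]

/-- Supplies the consistency condition of `filter_maskAndCount_eq` for every fibre that contains an
admissible pair. -/
theorem card_obsFalse_trainMask {L : ℕ → Finset (Fin n × Fin n) → ℕ} {a : BMat n}
    {p : BMat n × Finset (Fin n × Fin n)} (hp : p ∈ admissible L a) :
    (obsFalse a (trainMask p.1 p.2)).card +
      L (obsFalse a p.1).card (obsTrue a (trainMask p.1 p.2)) = (obsFalse a p.1).card := by
  simp only [admissible, Finset.mem_filter, Finset.mem_univ, true_and, Finset.mem_powersetCard,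
    calSize] at hp
  obtain ⟨hD, hcard⟩ := hp
  have h1 := subset_nullSet_trainMask hD
  have h2 := unmask_trainMask hD
  have h3 := obsTrue_unmask h1
  have h4 := card_obsFalse_unmask h1
  rw [h2] at h3 h4
  rw [← h3, ← hcard, h4]

/-- Too many false edges with small p-values. -/
def Exceeds {d : ℕ} (L : ℕ → Finset (Fin n × Fin n) → ℕ) (g : Obs n d → RMat n n) (δ : ℝ)
    (a : BMat n) (x : RMat n d) (p : BMat n × Finset (Fin n × Fin n)) : Prop :=
  ∃ t ∈ Set.Icc (0 : ℝ) 1,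
    ((testSet p.1).card : ℝ) * (t + lam (testSet p.1).card (calSize L a p.1) δ) <
      ({e ∈ nullSet a p.1 | pValue (score g a x p.1 p.2) p.2 e ≤ t}.card : ℝ)

open Classical in
-- On a fibre the weight is a constant `c` and the scores are one fixed function, so the claim
-- reduces to counting subsets of `W`.
theorem sum_fiber_exceeds_le {d : ℕ} {w₀ w₁ : ℝ} (hw₀ : w₀ ∈ Set.Icc (0 : ℝ) 1)
    (hw₁ : w₁ ∈ Set.Icc (0 : ℝ) 1) (L : ℕ → Finset (Fin n × Fin n) → ℕ)
    (g : Obs n d → RMat n n) {δ : ℝ} (hδ : δ ∈ Set.Ioo (0 : ℝ) 1) (a : BMat n) (x : RMat n d)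
    (hinj : ∀ p, pairWeight w₀ w₁ L a p ≠ 0 → Function.Injective (score g a x p.1 p.2))
    {p₀ : BMat n × Finset (Fin n × Fin n)} (hp₀ : p₀ ∈ admissible L a) :
    ∑ p ∈ admissible L a with maskAndCount a p = maskAndCount a p₀,
        (if Exceeds L g δ a x p then pairWeight w₀ w₁ L a p else 0) ≤
      δ * ∑ p ∈ admissible L a with maskAndCount a p = maskAndCount a p₀,
        pairWeight w₀ w₁ L a p := by
  set τ := trainMask p₀.1 p₀.2 with hτ
  set k := (obsFalse a p₀.1).card with hk
  have hkey : maskAndCount a p₀ = (τ, k) := rfl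
  have hkl : (obsFalse a τ).card + L k (obsTrue a τ) = k := card_obsFalse_trainMask hp₀
  have hmem : p₀ ∈ {p ∈ admissible L a | maskAndCount a p = (τ, k)} :=
    Finset.mem_filter.2 ⟨hp₀, hkey⟩
  rw [hkey]
  rw [filter_maskAndCount_eq hkl] at hmem ⊢
  set N := L k (obsTrue a τ) with hN
  set W := nullSet a τ with hW
  have hinjOn : ∀ D ∈ W.powersetCard N, ∀ D' ∈ W.powersetCard N,
      (unmask τ D, D) = (unmask τ D', D') → D = D' := fun D _ D' _ h => (Prod.ext_iff.1 h).2
  rw [Finset.sum_image hinjOn, Finset.sum_image hinjOn]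
  have hcal : ∀ D ∈ W.powersetCard N, calSize L a (unmask τ D) = N := by
    intro D hD
    rw [Finset.mem_powersetCard] at hD
    rw [calSize, card_obsFalse_unmask hD.1, obsTrue_unmask hD.1, hD.2, hkl]
  obtain ⟨c, hc⟩ : ∃ c, ∀ D ∈ W.powersetCard N, pairWeight w₀ w₁ L a (unmask τ D, D) = c := by
    refine ⟨w₀ ^ ((obsFalse a τ).card + N) * (1 - w₀) ^ (W.card - N) *
      (w₁ ^ (obsTrue a τ).card * (1 - w₁) ^ (testSet τ \ nullSet a τ).card) *
      ((k.choose N : ℕ) : ℝ)⁻¹, fun D hD => ?_⟩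
    have h1 := hcal D hD
    rw [Finset.mem_powersetCard] at hD
    rw [pairWeight, sampleWeight_unmask hD.1, calWeight, h1, card_obsFalse_unmask hD.1, hD.2, hkl,
      if_pos]
    rw [Finset.mem_powersetCard, obsFalse_unmask hD.1]
    exact ⟨Finset.subset_union_right, hD.2⟩
  obtain ⟨D₀, hD₀, he₀⟩ := Finset.mem_image.1 hmem
  have hc0 : 0 ≤ c := hc D₀ hD₀ ▸ pairWeight_nonneg hw₀ hw₁ _ _ _
  rw [Finset.sum_congr rfl hc, Finset.sum_congr rfl fun D hD => by rw [hc D hD],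
    ← Finset.sum_filter, Finset.sum_const, Finset.sum_const, Finset.card_powersetCard,
    nsmul_eq_mul, nsmul_eq_mul, ← mul_assoc]
  -- Absence of ties is known only for pairs of positive weight; a fibre of weight zero contributes
  -- nothing to either side.
  rcases hc0.eq_or_lt with rfl | hcpos
  · simp
  refine mul_le_mul_of_nonneg_right ?_ hc0
  set S : Fin n × Fin n → ℝ := fun e => g (observed a τ, x, τ) e.1 e.2 with hS
  have hSinj : Function.Injective S := by
    have := hinj (unmask τ D₀, D₀) (by rw [hc D₀ hD₀]; exact hcpos.ne')
    rwa [score_unmask (Finset.mem_powersetCard.1 hD₀).1] at this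
  have hNW : N ≤ W.card := by
    have := Finset.mem_powersetCard.1 hD₀
    exact this.2 ▸ Finset.card_le_card this.1
  have hWT : W ⊆ testSet τ := by
    intro e he
    simp only [hW, nullSet, testSet, Finset.mem_filter] at he ⊢
    exact ⟨he.1, he.2.1⟩
  have hm : W.card - N ≤ (testSet τ).card - N := Nat.sub_le_sub_right (Finset.card_le_card hWT) N
  refine le_trans (le_of_eq ?_) (card_filter_exceed_le hSinj.injOn hNW hm hδ)
  congr 2
  refine Finset.filter_congr fun D hD => ?_
  have h1 := hcal D hD
  rw [Finset.mem_powersetCard] at hD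
  simp only [Exceeds, h1, nullSet_unmask, testSet_unmask, score_unmask hD.1,
    Finset.card_sdiff_of_subset (hD.1.trans hWT), hD.2]
  rfl

open Classical in
theorem sum_exceeds_le {d : ℕ} {w₀ w₁ : ℝ} (hw₀ : w₀ ∈ Set.Icc (0 : ℝ) 1)
    (hw₁ : w₁ ∈ Set.Icc (0 : ℝ) 1) (L : ℕ → Finset (Fin n × Fin n) → ℕ)
    (g : Obs n d → RMat n n) {δ : ℝ} (hδ : δ ∈ Set.Ioo (0 : ℝ) 1) (a : BMat n) (x : RMat n d)
    (hinj : ∀ p, pairWeight w₀ w₁ L a p ≠ 0 → Function.Injective (score g a x p.1 p.2)) :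
    ∑ p, (if Exceeds L g δ a x p then pairWeight w₀ w₁ L a p else 0) ≤
      δ * ∑ p, pairWeight w₀ w₁ L a p := by
  rw [← Finset.sum_subset (Finset.subset_univ (admissible L a)) fun p _ hp => by
      rw [pairWeight_of_notMem _ _ hp, ite_self],
    ← Finset.sum_subset (Finset.subset_univ (admissible L a)) fun p _ hp =>
      pairWeight_of_notMem _ _ hp]
  have hmaps : ∀ p ∈ admissible L a,
      maskAndCount a p ∈ (admissible L a).image (maskAndCount a) :=
    fun p hp => Finset.mem_image_of_mem _ hp
  rw [← Finset.sum_fiberwise_of_maps_to hmaps, ← Finset.sum_fiberwise_of_maps_to hmaps,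
    Finset.mul_sum]
  refine Finset.sum_le_sum fun y hy => ?_
  obtain ⟨p₀, hp₀, rfl⟩ := Finset.mem_image.1 hy
  exact sum_fiber_exceeds_le hw₀ hw₁ L g hδ a x hinj hp₀

end Weights

/-! ### Measurability -/

section Measurability

variable {n d : ℕ}

theorem measurable_score {g : Obs n d → RMat n n} (hg : Measurable g) (a : BMat n)
    (p : BMat n × Finset (Fin n × Fin n)) (e : Fin n × Fin n) :
    Measurable fun x : RMat n d => score g a x p.1 p.2 e := by
  have h : Measurable fun x : RMat n d => g (observed a p.1, x, trainMask p.1 p.2) :=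
    hg.comp (measurable_const.prodMk (measurable_id.prodMk measurable_const))
  exact (measurable_pi_apply e.2).comp ((measurable_pi_apply e.1).comp h)

/-- There are finitely many adjacency matrices, so measurability can be checked slice by slice. -/
theorem measurableSet_of_fst {β : Type*} [MeasurableSpace β] {q : BMat n → β → Prop}
    (hq : ∀ a, MeasurableSet {x | q a x}) : MeasurableSet {y : BMat n × β | q y.1 y.2} := by
  have : {y : BMat n × β | q y.1 y.2} = ⋃ a, {a} ×ˢ {x | q a x} := by
    ext ⟨a, x⟩
    simp
  rw [this]
  exact MeasurableSet.iUnion fun a => (MeasurableSet.of_discrete).prod (hq a)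

theorem measurableSet_exceeds (L : ℕ → Finset (Fin n × Fin n) → ℕ) {g : Obs n d → RMat n n}
    (hg : Measurable g) (δ : ℝ) (p : BMat n × Finset (Fin n × Fin n)) :
    MeasurableSet {y : BMat n × RMat n d | Exceeds L g δ y.1 y.2 p} := by
  refine measurableSet_of_fst (q := fun a x => Exceeds L g δ a x p) fun a => ?_
  have hrank : Measurable fun (x : RMat n d) (e : Fin n × Fin n) =>
      {f ∈ p.2 | score g a x p.1 p.2 e ≤ score g a x p.1 p.2 f}.card := by
    refine measurable_pi_iff.2 fun e => ?_
    simp_rw [Finset.card_filter]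
    exact Finset.measurable_sum _ fun f _ => Measurable.ite
      (measurableSet_le (measurable_score hg a p e) (measurable_score hg a p f))
      measurable_const measurable_const
  -- The scores enter only through integer ranks. The uncountable quantifier over `t` is thus
  -- confined to a discrete space, where every set is measurable.
  have hset : MeasurableSet {c : Fin n × Fin n → ℕ | ∃ t ∈ Set.Icc (0 : ℝ) 1,
      ((testSet p.1).card : ℝ) * (t + lam (testSet p.1).card (calSize L a p.1) δ) <
        ({e ∈ nullSet a p.1 | ((c e : ℝ) + 1) / ((p.2.card : ℝ) + 1) ≤ t}.card : ℝ)} :=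
    MeasurableSet.of_discrete
  convert hrank hset using 1
  ext x
  simp only [Exceeds, pValue_eq, Set.mem_ofPred_eq, Set.mem_preimage]

theorem measurableSet_injective_score {g : Obs n d → RMat n n} (hg : Measurable g)
    (p : BMat n × Finset (Fin n × Fin n)) :
    MeasurableSet {y : BMat n × RMat n d | Function.Injective (score g y.1 y.2 p.1 p.2)} := by
  refine measurableSet_of_fst (q := fun a x => Function.Injective (score g a x p.1 p.2))
    fun a => ?_
  have : {x : RMat n d | Function.Injective (score g a x p.1 p.2)} =
      ⋂ e, ⋂ f, {x | score g a x p.1 p.2 e = score g a x p.1 p.2 f → e = f} := by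
    ext x
    simp [Function.Injective]
  rw [this]
  refine MeasurableSet.iInter fun e => MeasurableSet.iInter fun f => ?_
  by_cases h : e = f
  · simp [h]
  · simp only [h, imp_false]
    exact (measurableSet_eq_fun (measurable_score hg a p e) (measurable_score hg a p f)).compl

end Measurability

/-! ### The conditional law of the sampling matrix and the calibration set -/

section Conditional

theorem stronglyMeasurable_comp_sigmaOf {Ω α : Type*} [MeasurableSpace α] (Y : Ω → α) {f : α → ℝ}
    (hf : Measurable f) : StronglyMeasurable[sigmaOf Y] fun s => f (Y s) :=
  (hf.comp (comap_measurable Y)).stronglyMeasurable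

variable {Ω : Type*} [MeasurableSpace Ω] {P : Measure Ω} [IsProbabilityMeasure P] {n d : ℕ}
  {Astar : Ω → BMat n} {X : Ω → RMat n d} {samp : Ω → BMat n} {Dcal : Ω → Finset (Fin n × Fin n)}

/-- The conditional probability of a value of `(samp, Dcal)` given `(Astar, X)`. -/
theorem condExp_samp_Dcal (hAstar : Measurable Astar) (hX : Measurable X) (hsamp : Measurable samp)
    (hDcal : ∀ D, MeasurableSet {s | Dcal s = D}) {w₀ w₁ : ℝ}
    (hlaw : ∀ o : BMat n, P⟦{s | samp s = o} | sigmaOf fun s => (Astar s, X s)⟧ =ᵐ[P]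
      fun s => sampleWeight w₀ w₁ (Astar s) o)
    {L : ℕ → Finset (Fin n × Fin n) → ℕ}
    (hcal : ∀ D, P⟦{s | Dcal s = D} | sigmaOf fun s => (Astar s, X s, samp s)⟧ =ᵐ[P]
      fun s => calWeight L (Astar s) (samp s) D)
    (p : BMat n × Finset (Fin n × Fin n)) :
    P⟦{s | samp s = p.1} ∩ {s | Dcal s = p.2} | sigmaOf fun s => (Astar s, X s)⟧ =ᵐ[P]
      fun s => pairWeight w₀ w₁ L (Astar s) p := by
  obtain ⟨o, D⟩ := p
  set Y : Ω → BMat n × RMat n d := fun s => (Astar s, X s) with hY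
  set Z : Ω → BMat n × RMat n d × BMat n := fun s => (Astar s, X s, samp s) with hZ
  have hYm : Measurable Y := hAstar.prodMk hX
  have hZm : Measurable Z := hAstar.prodMk (hX.prodMk hsamp)
  have hYZ : sigmaOf Y ≤ sigmaOf Z := by
    have : Measurable[sigmaOf Z] Y :=
      (measurable_fst.prodMk (measurable_fst.comp measurable_snd)).comp (comap_measurable Z)
    exact this.comap_le
  have hso : MeasurableSet {s | samp s = o} := hsamp (measurableSet_singleton o)
  set I : Ω → ℝ := {s | samp s = o}.indicator fun _ => (1 : ℝ) with hI
  set J : Ω → ℝ := {s | Dcal s = D}.indicator fun _ => (1 : ℝ) with hJ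
  have hIint : Integrable I P := (integrable_const _).indicator hso
  have hJint : Integrable J P := (integrable_const _).indicator (hDcal D)
  have hIJ : ({s | samp s = o} ∩ {s | Dcal s = D}).indicator (fun _ => (1 : ℝ)) = I * J := by
    funext s
    by_cases h1 : samp s = o <;> by_cases h2 : Dcal s = D <;>
      simp [hI, hJ, h1, h2]
  have hIm : StronglyMeasurable[sigmaOf Z] I := by
    refine stronglyMeasurable_const.indicator ?_
    exact ⟨{z | z.2.2 = o}, (measurable_snd.comp measurable_snd) (measurableSet_singleton o), rfl⟩
  -- On `{samp = o}` the sampling matrix may be replaced by `o`, which leaves a calibration weight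
  -- measurable with respect to `Y`; the tower property then brings in the law of `samp`.
  have h1 : P[I * J | sigmaOf Z] =ᵐ[P] fun s => calWeight L (Astar s) o D * I s := by
    have hb : ∀ᵐ s ∂P, ‖I s‖ ≤ 1 := Filter.Eventually.of_forall fun s => by
      by_cases h : samp s = o <;> simp [hI, h]
    filter_upwards [condExp_stronglyMeasurable_mul_of_bound hZm.comap_le hIm hJint 1 hb, hcal D]
      with s hs hs'
    rw [hs, Pi.mul_apply, hs']
    by_cases h : samp s = o <;> simp [hI, h]
  have hcm : Measurable fun y : BMat n × RMat n d => calWeight L y.1 o D :=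
    (Measurable.of_discrete (f := fun a : BMat n => calWeight L a o D)).comp measurable_fst
  have hcb : ∀ᵐ s ∂P, ‖calWeight L (Astar s) o D‖ ≤ 1 := Filter.Eventually.of_forall fun s => by
    rw [Real.norm_of_nonneg (calWeight_nonneg _ _ _ _), calWeight]
    split_ifs
    · exact Nat.cast_inv_le_one _
    · exact zero_le_one
  calc P[({s | samp s = o} ∩ {s | Dcal s = D}).indicator (fun _ => (1 : ℝ)) | sigmaOf Y]
      = P[I * J | sigmaOf Y] := by rw [hIJ]
    _ =ᵐ[P] P[P[I * J | sigmaOf Z] | sigmaOf Y] :=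
        (condExp_condExp_of_le hYZ hZm.comap_le).symm
    _ =ᵐ[P] P[(fun s => calWeight L (Astar s) o D) * I | sigmaOf Y] := condExp_congr_ae h1
    _ =ᵐ[P] (fun s => calWeight L (Astar s) o D) * P[I | sigmaOf Y] :=
        condExp_stronglyMeasurable_mul_of_bound hYm.comap_le
          (stronglyMeasurable_comp_sigmaOf Y hcm) hIint 1 hcb
    _ =ᵐ[P] fun s => pairWeight w₀ w₁ L (Astar s) (o, D) := by
        filter_upwards [hlaw o] with s hs
        rw [Pi.mul_apply, hs, pairWeight, mul_comm]

/-- The conditional probability given `(Astar, X)` of an event that is determined by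
`(Astar, X, samp, Dcal)`. -/
theorem condExp_event (hAstar : Measurable Astar) (hX : Measurable X) (hsamp : Measurable samp)
    (hDcal : ∀ D, MeasurableSet {s | Dcal s = D}) {w₀ w₁ : ℝ}
    (hlaw : ∀ o : BMat n, P⟦{s | samp s = o} | sigmaOf fun s => (Astar s, X s)⟧ =ᵐ[P]
      fun s => sampleWeight w₀ w₁ (Astar s) o)
    {L : ℕ → Finset (Fin n × Fin n) → ℕ}
    (hcal : ∀ D, P⟦{s | Dcal s = D} | sigmaOf fun s => (Astar s, X s, samp s)⟧ =ᵐ[P]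
      fun s => calWeight L (Astar s) (samp s) D)
    (E : BMat n × Finset (Fin n × Fin n) → Set (BMat n × RMat n d))
    (hE : ∀ p, MeasurableSet (E p)) :
    P⟦{s | (Astar s, X s) ∈ E (samp s, Dcal s)} | sigmaOf fun s => (Astar s, X s)⟧ =ᵐ[P]
      fun s => ∑ p, (E p).indicator (fun _ => (1 : ℝ)) (Astar s, X s) *
        pairWeight w₀ w₁ L (Astar s) p := by
  set Y : Ω → BMat n × RMat n d := fun s => (Astar s, X s) with hY
  have hYm : Measurable Y := hAstar.prodMk hX
  set K : BMat n × Finset (Fin n × Fin n) → Ω → ℝ := fun p =>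
    ({s | samp s = p.1} ∩ {s | Dcal s = p.2}).indicator fun _ => (1 : ℝ) with hK
  set F : BMat n × Finset (Fin n × Fin n) → Ω → ℝ := fun p s =>
    (E p).indicator (fun _ => (1 : ℝ)) (Y s) with hF
  have hKint : ∀ p, Integrable (K p) P := fun p => (integrable_const _).indicator
    ((hsamp (measurableSet_singleton p.1)).inter (hDcal p.2))
  have hFm : ∀ p, StronglyMeasurable[sigmaOf Y] (F p) := fun p =>
    stronglyMeasurable_comp_sigmaOf Y (measurable_const.indicator (hE p))
  have hFb : ∀ p, ∀ᵐ s ∂P, ‖F p s‖ ≤ 1 := fun p => Filter.Eventually.of_forall fun s => by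
    by_cases h : Y s ∈ E p <;> simp [hF, h]
  -- Splitting over the finitely many values of `(samp, Dcal)` makes each factor `F p` measurable
  -- with respect to `Y`, so it can be pulled out.
  have hdec : ({s | Y s ∈ E (samp s, Dcal s)}.indicator fun _ => (1 : ℝ)) = ∑ p, F p * K p := by
    funext s
    rw [Finset.sum_apply, Finset.sum_eq_single (samp s, Dcal s)]
    · by_cases h : Y s ∈ E (samp s, Dcal s) <;> simp [hF, hK, h]
    · rintro ⟨o, D⟩ - hne
      have : ¬(samp s = o ∧ Dcal s = D) := by
        rintro ⟨rfl, rfl⟩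
        exact hne rfl
      simp only [Pi.mul_apply, hK]
      rw [Set.indicator_of_notMem (by simpa using this), mul_zero]
    · simp
  rw [hdec]
  have hpull : ∀ p, P[F p * K p | sigmaOf Y] =ᵐ[P] F p * P[K p | sigmaOf Y] := fun p =>
    condExp_stronglyMeasurable_mul_of_bound hYm.comap_le (hFm p) (hKint p) 1 (hFb p)
  have hFK : ∀ p ∈ Finset.univ, Integrable (F p * K p) P := fun p _ =>
    (hKint p).bdd_mul ((hFm p).mono hYm.comap_le).aestronglyMeasurable (hFb p)
  have hall : ∀ᵐ s ∂P, ∀ p, P[F p * K p | sigmaOf Y] s =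
      F p s * pairWeight w₀ w₁ L (Astar s) p := by
    rw [ae_all_iff]
    intro p
    filter_upwards [hpull p, condExp_samp_Dcal hAstar hX hsamp hDcal hlaw hcal p] with s h1 h2
    rw [h1, Pi.mul_apply, h2]
  filter_upwards [condExp_finsetSum hFK (sigmaOf Y), hall] with s h1 h2
  rw [h1, Finset.sum_apply]
  exact Finset.sum_congr rfl fun p _ => h2 p

theorem measurableSet_event (hAstar : Measurable Astar) (hX : Measurable X)
    (hsamp : Measurable samp) (hDcal : ∀ D, MeasurableSet {s | Dcal s = D})
    (E : BMat n × Finset (Fin n × Fin n) → Set (BMat n × RMat n d))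
    (hE : ∀ p, MeasurableSet (E p)) :
    MeasurableSet {s | (Astar s, X s) ∈ E (samp s, Dcal s)} := by
  have : {s | (Astar s, X s) ∈ E (samp s, Dcal s)} = ⋃ p : BMat n × Finset (Fin n × Fin n),
      {s | samp s = p.1} ∩ {s | Dcal s = p.2} ∩ (fun s => (Astar s, X s)) ⁻¹' E p := by
    ext s
    simp
  rw [this]
  exact MeasurableSet.iUnion fun p =>
    ((hsamp (measurableSet_singleton p.1)).inter (hDcal p.2)).inter ((hAstar.prodMk hX) (hE p))

theorem one_sub_le_condExp_not_exceeds (hAstar : Measurable Astar) (hX : Measurable X)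
    (hsamp : Measurable samp) (hDcal : ∀ D, MeasurableSet {s | Dcal s = D}) {w₀ w₁ : ℝ}
    (hw₀ : w₀ ∈ Set.Icc (0 : ℝ) 1) (hw₁ : w₁ ∈ Set.Icc (0 : ℝ) 1)
    (hlaw : ∀ o : BMat n, P⟦{s | samp s = o} | sigmaOf fun s => (Astar s, X s)⟧ =ᵐ[P]
      fun s => sampleWeight w₀ w₁ (Astar s) o)
    {L : ℕ → Finset (Fin n × Fin n) → ℕ}
    (hcal : ∀ D, P⟦{s | Dcal s = D} | sigmaOf fun s => (Astar s, X s, samp s)⟧ =ᵐ[P]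
      fun s => calWeight L (Astar s) (samp s) D)
    {g : Obs n d → RMat n n} (hg : Measurable g)
    (hties : ∀ᵐ s ∂P, Function.Injective (score g (Astar s) (X s) (samp s) (Dcal s)))
    {δ : ℝ} (hδ : δ ∈ Set.Ioo (0 : ℝ) 1) :
    ∀ᵐ s ∂P, 1 - δ ≤ (P⟦{s | ¬ Exceeds L g δ (Astar s) (X s) (samp s, Dcal s)} |
      sigmaOf fun s => (Astar s, X s)⟧) s := by
  classical
  have hone := condExp_event hAstar hX hsamp hDcal hlaw hcal (fun _ => Set.univ)
    fun _ => MeasurableSet.univ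
  have htie := condExp_event hAstar hX hsamp hDcal hlaw hcal
    (fun p => {y | Function.Injective (score g y.1 y.2 p.1 p.2)}ᶜ)
    fun p => (measurableSet_injective_score hg p).compl
  have hexc := condExp_event hAstar hX hsamp hDcal hlaw hcal
    (fun p => {y | Exceeds L g δ y.1 y.2 p}ᶜ) fun p => (measurableSet_exceeds L hg δ p).compl
  have htie0 : P⟦{s | (Astar s, X s) ∈ {y : BMat n × RMat n d |
      Function.Injective (score g y.1 y.2 (samp s) (Dcal s))}ᶜ} |
        sigmaOf fun s => (Astar s, X s)⟧ =ᵐ[P] 0 := by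
    refine (condExp_congr_ae (g := 0) ?_).trans (by rw [condExp_zero])
    filter_upwards [hties] with s hs
    simp [hs]
  filter_upwards [hone, htie, hexc, htie0] with s h1 h2 h3 h4
  -- The total weight is the conditional probability of the sure event.
  have hsum : ∑ p, pairWeight w₀ w₁ L (Astar s) p = 1 := by
    simp only [Set.mem_univ, Set.ofPred_true, Set.indicator_univ, one_mul] at h1
    rw [← h1, condExp_const (hAstar.prodMk hX).comap_le]
  -- Ties have conditional probability zero, and this is a sum of nonnegative terms; so no value of
  -- positive weight has a tie.
  have hinj : ∀ p, pairWeight w₀ w₁ L (Astar s) p ≠ 0 →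
      Function.Injective (score g (Astar s) (X s) p.1 p.2) := by
    intro p hp
    rw [h2, Pi.zero_apply, Finset.sum_eq_zero_iff_of_nonneg fun q _ => mul_nonneg
      (Set.indicator_nonneg (fun _ _ => zero_le_one) _) (pairWeight_nonneg hw₀ hw₁ _ _ _)] at h4
    by_contra hcon
    refine hp ?_
    simpa [hcon] using h4 p (Finset.mem_univ p)
  have hbad := sum_exceeds_le hw₀ hw₁ L g hδ (Astar s) (X s) hinj
  rw [hsum, mul_one] at hbad
  refine le_trans ?_ h3.ge
  have : ∀ p, {y : BMat n × RMat n d | Exceeds L g δ y.1 y.2 p}ᶜ.indicator (fun _ => (1 : ℝ))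
      (Astar s, X s) * pairWeight w₀ w₁ L (Astar s) p = pairWeight w₀ w₁ L (Astar s) p -
        if Exceeds L g δ (Astar s) (X s) p then pairWeight w₀ w₁ L (Astar s) p else 0 := by
    intro p
    by_cases h : Exceeds L g δ (Astar s) (X s) p <;> simp [h]
  rw [Finset.sum_congr rfl fun p _ => this p, Finset.sum_sub_distrib, hsum]
  linarith

end Conditional

/-! ### From exceedances to the false discovery proportion -/

/-- Both sides of the bound have the same positive denominator `1 ∨ |R(t)|`, so only the number of
rejected nulls matters. -/
theorem forall_fdp_le_iff {n d : ℕ} (L : ℕ → Finset (Fin n × Fin n) → ℕ) (g : Obs n d → RMat n n)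
    (δ : ℝ) (a : BMat n) (x : RMat n d) (o : BMat n) (D : Finset (Fin n × Fin n)) :
    (∀ t ∈ Set.Icc (0 : ℝ) 1, fdp (nullSet a o) (rejSet g a x o D t) ≤
      ((testSet o).card : ℝ) / (max 1 (rejSet g a x o D t).card : ℕ) *
        (t + lam (testSet o).card (calSize L a o) δ)) ↔ ¬ Exceeds L g δ a x (o, D) := by
  rw [Exceeds]
  push Not
  refine forall₂_congr fun t _ => ?_
  have hinter : nullSet a o ∩ rejSet g a x o D t =
      {e ∈ nullSet a o | pValue (score g a x o D) D e ≤ t} := by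
    ext e
    simp only [nullSet, rejSet, testSet, Finset.mem_inter, Finset.mem_filter, Finset.mem_univ,
      true_and]
    tauto
  have hpos : (0 : ℝ) < (max 1 (rejSet g a x o D t).card : ℕ) := by
    exact_mod_cast lt_of_lt_of_le Nat.one_pos (le_max_left _ _)
  rw [fdp, hinter, div_mul_eq_mul_div, div_le_div_iff_of_pos_right hpos]

end LinkPred

/-- `Astar` is the true adjacency matrix, `X` the covariate matrix, `samp` the sampling matrix and
`Dcal` the calibration set. -/
theorem theorem2 {Ω : Type*} [MeasurableSpace Ω] (P : Measure Ω) [IsProbabilityMeasure P]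
    (n d : ℕ)
    (Astar : Ω → LinkPred.BMat n) (X : Ω → LinkPred.RMat n d)
    (samp : Ω → LinkPred.BMat n) (Dcal : Ω → Finset (Fin n × Fin n))
    (hAstar : Measurable Astar) (hX : Measurable X) (hsamp : Measurable samp)
    (hDcal : ∀ D, MeasurableSet {s | Dcal s = D})
    -- double standard sampling: given `(Astar, X)`, the entries of `samp` are independent Bernoulli
    (w₀ w₁ : ℝ) (hw₀ : w₀ ∈ Set.Icc (0 : ℝ) 1) (hw₁ : w₁ ∈ Set.Icc (0 : ℝ) 1)
    (hlaw : ∀ o : LinkPred.BMat n,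
      P⟦{s | samp s = o} | LinkPred.sigmaOf fun s => (Astar s, X s)⟧ =ᵐ[P]
        fun s => ∏ i, ∏ j, LinkPred.sampleProb w₀ w₁ (Astar s i j) (o i j))
    -- the calibration size is a function of `|D⁰|` and `D¹`
    (L : ℕ → Finset (Fin n × Fin n) → ℕ) (hL : ∀ k D, L k D ≤ k)
    -- given everything else, `Dcal` is a uniform subset of `D⁰` of that size
    (hcal : ∀ D : Finset (Fin n × Fin n),
      P⟦{s | Dcal s = D} | LinkPred.sigmaOf fun s => (Astar s, X s, samp s)⟧ =ᵐ[P]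
        fun s =>
          if D ∈ (LinkPred.obsFalse (Astar s) (samp s)).powersetCard
              (LinkPred.calSize L (Astar s) (samp s))
          then (((LinkPred.obsFalse (Astar s) (samp s)).card.choose
              (LinkPred.calSize L (Astar s) (samp s)) : ℕ) : ℝ)⁻¹
          else 0)
    -- the score function, without ties
    (g : LinkPred.Obs n d → LinkPred.RMat n n) (hg : Measurable g)
    (hties : ∀ᵐ s ∂P,
      Function.Injective (LinkPred.score g (Astar s) (X s) (samp s) (Dcal s)))
    (δ : ℝ) (hδ : δ ∈ Set.Ioo (0 : ℝ) 1) :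
    let m : Ω → ℕ := fun s => (LinkPred.testSet (samp s)).card
    let ℓ : Ω → ℕ := fun s => LinkPred.calSize L (Astar s) (samp s)
    let R : Ω → ℝ → Finset (Fin n × Fin n) := fun s t =>
      LinkPred.rejSet g (Astar s) (X s) (samp s) (Dcal s) t
    let good : Set Ω := {s | ∀ t ∈ Set.Icc (0 : ℝ) 1,
      LinkPred.fdp (LinkPred.nullSet (Astar s) (samp s)) (R s t) ≤
        (m s : ℝ) / (max 1 (R s t).card : ℕ) * (t + LinkPred.lam (m s) (ℓ s) δ)}
    -- the bound holds with conditional probability at least `1 - δ`, over the draw of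
    -- `samp` and `Dcal` given `(Astar, X)`, and hence also with probability at least `1 - δ`
    (∀ᵐ s ∂P, 1 - δ ≤ (P⟦good | LinkPred.sigmaOf fun s => (Astar s, X s)⟧) s) ∧
    1 - δ ≤ P.real good ∧
    -- the explicit estimate of the quantile
    (∀ m' ℓ' : ℕ, 1 ≤ m' → 1 ≤ ℓ' →
      LinkPred.lam m' ℓ' δ ≤
        Real.sqrt ((Real.log δ⁻¹ + Real.log (1 + 2 * Real.sqrt Real.pi * (min m' ℓ' : ℕ))) /
          (min m' ℓ' : ℕ))) := by
  intro m ℓ R good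
  have hgood : good = {s | ¬ LinkPred.Exceeds L g δ (Astar s) (X s) (samp s, Dcal s)} :=
    Set.ext fun s => LinkPred.forall_fdp_le_iff L g δ (Astar s) (X s) (samp s) (Dcal s)
  have hcond : ∀ᵐ s ∂P, 1 - δ ≤ (P⟦good | LinkPred.sigmaOf fun s => (Astar s, X s)⟧) s := by
    rw [hgood]
    exact LinkPred.one_sub_le_condExp_not_exceeds hAstar hX hsamp hDcal hw₀ hw₁ hlaw hcal hg
      hties hδ
  refine ⟨hcond, ?_, fun m' ℓ' hm hℓ => LinkPred.lam_le_sqrt hm hℓ hδ⟩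
  have hmeas : MeasurableSet good := by
    rw [hgood]
    exact LinkPred.measurableSet_event hAstar hX hsamp hDcal
      (fun p => {y | LinkPred.Exceeds L g δ y.1 y.2 p}ᶜ)
      fun p => (LinkPred.measurableSet_exceeds L hg δ p).compl
  -- Integrating the conditional bound gives the unconditional one.
  have hint := integral_mono_ae (integrable_const (1 - δ)) integrable_condExp hcond
  rw [integral_condExp (hAstar.prodMk hX).comap_le] at hint
  simpa [integral_indicator_const, hmeas] using hint
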